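/- Let $(W,S)$ be a finite Coxeter system with length function $\ell$ and longest element $w_0$, and let $\mathbb{K}$ be a field. The $0$-Hecke algebra $H_W(0)$ is the associative unital $\mathbb{K}$-algebra generated by $\{\pi_s : s\in S\}$ with relations $\pi_s^2=\pi_s$ and $\pi_s\pi_t\pi_s\cdots=\pi_t\pi_s\pi_t\cdots$ ($m(s,t)$ factors on each side) for distinct $s,t\in S$. Write $u\le_L v$ if $v=s_1\cdots s_k u$ for some $s_1,\dots,s_k\in S$ with $\ell(v)=\ell(u)+k$, and for $u\le_L v$ let $[u,v]_L=\{w : u\le_L w\le_L v\}$. Let $\mathrm{B}(u,v)$ be the $H_W(0)$-module with $\mathbb{K}$-basis $[u,v]_L$ and action $$\pi_s w=\begin{cases} w & \text{if } \ell(sw)<\ell(w),\\ sw & \text{if } \ell(sw)>\ell(w) \text{ and } sw\in[u,v]_L,\\ 0 & \text{if } \ell(sw)>\ell(w) \text{ and } sw\notin[u,v]_L.\end{cases}$$ If $Y$ is an upper order ideal of the poset $[u,v]_L$, then its span $\mathbb{K}Y$ is an $H_W(0)$-submodule of $\mathrm{B}(u,v)$. Let $\phi$ and $\theta$ be the automorphisms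 of $H_W(0)$ given by $\phi(\pi_s)=\pi_{w_0sw_0}$ and $\theta(\pi_s)=1-\pi_s$, and let $\chi$ be the anti-automorphism with $\chi(\pi_s)=\pi_s$. For an $H_W(0)$-module $M$, let $\phi[M]$ and $\theta[M]$ be the space $M$ on which $a\in H_W(0)$ acts as $\phi(a)$, respectively $\theta(a)$, and let $\chi[M]$ be the dual space $M^*$ with action $(a\cdot f)(m)=f(\chi(a)m)$. Put $\hat{\theta}[M]=\theta[\chi[M]]$ and $\hat{\omega}[M]=\phi[\theta[\chi[M]]]$. Write $x^{w_0}=w_0xw_0$. **Theorem.** Let $u\le_L v$ in $W$ and let $Y$ be an upper order ideal in $[u,v]_L$. Then $u^{w_0}\le_L v^{w_0}$, $vw_0\le_L uw_0$ and $w_0v\le_L w_0u$; the set $w_0Yw_0$ is an upper order ideal in $[u^{w_0},v^{w_0}]_L$, and $[vw_0,uw_0]_L\setminus Yw_0$ and $[w_0v,w_0u]_L\setminus w_0Y$ are upper order ideals in $[vw_0,uw_0]_L$ and $[w_0v,w_0u]_L$ respectively; and there are isomorphisms of $H_W(0)$-modules $$\phi[\mathrm{B}(u,v)/\mathbb{K}Y]\cong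 \mathbb{K}\big([u^{w_0},v^{w_0}]_L\setminus w_0Yw_0\big):=\mathrm{B}(u^{w_0},v^{w_0})/\mathbb{K}(w_0Yw_0),$$ $$\hat{\theta}[\mathrm{B}(u,v)/\mathbb{K}Y]\cong \mathbb{K}\big([vw_0,uw_0]_L\setminus Yw_0\big)\subseteq \mathrm{B}(vw_0,uw_0),$$ $$\hat{\omega}[\mathrm{B}(u,v)/\mathbb{K}Y]\cong \mathbb{K}\big([w_0v,w_0u]_L\setminus w_0Y\big)\subseteq \mathrm{B}(w_0v,w_0u).$$ Here the module in the first line is the quotient module, which has the images of the elements of $[u^{w_0},v^{w_0}]_L\setminus w_0Yw_0$ as a basis; those in the second and third lines are submodules. -/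

import Mathlib

namespace ZeroHecke

open CoxeterSystem

section Geometric
open Polynomial.Chebyshev

/-- Entries of the (doubled) canonical bilinear form of a Coxeter matrix. -/
noncomputable def formCoeff {B : Type*} (M : CoxeterMatrix B) (i j : B) : ℝ :=
  -2 * Real.cos (Real.pi / M i j)

/-- The linear forms defining the reflections of the geometric representation. -/
noncomputable def coroot {B : Type*} (M : CoxeterMatrix B) (i : B) : Module.Dual ℝ (B →₀ ℝ) :=
  Finsupp.linearCombination ℝ (formCoeff M i)

theorem coroot_single {B : Type*} (M : CoxeterMatrix B) (i j : B) :
    coroot M i (Finsupp.single j 1) = formCoeff M i j := by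
  simp [coroot]

theorem coroot_self {B : Type*} (M : CoxeterMatrix B) (i : B) :
    coroot M i (Finsupp.single i 1) = 2 := by
  simp [coroot_single, formCoeff]

theorem formCoeff_symm {B : Type*} (M : CoxeterMatrix B) (i j : B) :
    formCoeff M i j = formCoeff M j i := by
  simp [formCoeff, M.symmetric i j]

/-- The reflections of the geometric representation. -/
noncomputable def geomRefl {B : Type*} (M : CoxeterMatrix B) (i : B) :
    (B →₀ ℝ) ≃ₗ[ℝ] (B →₀ ℝ) :=
  Module.reflection (coroot_self M i)

theorem four_cos_sq (x : ℝ) : (-2 * Real.cos x) * (-2 * Real.cos x) - 2 = 2 * Real.cos (2 * x) := by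
  rw [Real.cos_two_mul]; ring

theorem sin_two_pi_div_ne {m : ℕ} (hm : 3 ≤ m) : Real.sin (2 * (Real.pi / m)) ≠ 0 := by
  have h3 : (3 : ℝ) ≤ m := by exact_mod_cast hm
  have hpos : (0 : ℝ) < m := by linarith
  apply ne_of_gt
  apply Real.sin_pos_of_pos_of_lt_pi
  · positivity
  · rw [← mul_div_assoc, div_lt_iff₀ hpos]
    nlinarith [Real.pi_pos]

theorem geomRefl_liftable {B : Type*} (M : CoxeterMatrix B) : M.IsLiftable (geomRefl M) := by
  intro i j
  by_cases hij : i = j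
  · subst hij
    rw [M.diagonal, pow_one]
    ext1 z
    exact Module.involutive_reflection (coroot_self M i) z
  have hM1 := M.off_diagonal i j hij
  rcases Nat.lt_or_ge (M i j) 3 with h3 | h3
  · obtain h | h : M i j = 0 ∨ M i j = 2 := by omega
    · simp [h]
    · have hc : formCoeff M i j = 0 := by simp [formCoeff, h]
      have hc' : formCoeff M j i = 0 := by rw [formCoeff_symm, hc]
      rw [h, pow_two]
      apply LinearEquiv.ext
      intro z
      simp only [geomRefl, LinearEquiv.mul_apply, Module.reflection_apply, map_sub, map_smul,
        coroot_self, coroot_single, hc, hc', LinearEquiv.coe_one, id]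
      module
  · apply LinearEquiv.ext
    intro z
    set t := coroot M i (Finsupp.single j 1) * coroot M j (Finsupp.single i 1) - 2 with ht
    have ht' : t = 2 * Real.cos (2 * (Real.pi / M i j)) := by
      rw [ht, coroot_single, coroot_single, formCoeff_symm M j i, ← four_cos_sq]; rfl
    have hs := sin_two_pi_div_ne h3
    have hpos : (0 : ℝ) < M i j := by
      have : (3 : ℝ) ≤ M i j := by exact_mod_cast h3
      linarith
    have hS : ∀ n : ℤ, (S ℝ n).eval t =
        Real.sin ((n + 1) * (2 * (Real.pi / M i j))) / Real.sin (2 * (Real.pi / M i j)) := by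
      intro n
      rw [ht', eq_div_iff hs, S_two_mul_real_cos]
    have key := Module.reflection_mul_reflection_pow_apply (coroot_self M i) (coroot_self M j)
      (M i j) z t ht
    change ((geomRefl M i * geomRefl M j) ^ M i j) z = z
    refine key.trans ?_
    rcases Nat.even_or_odd' (M i j) with ⟨k, hk | hk⟩
    · have h1 : (((M i j : ℕ) : ℤ) - 2) / 2 = k - 1 := by omega
      have h2 : (((M i j : ℕ) : ℤ) - 1) / 2 = k - 1 := by omega
      have h0 : (S ℝ ((k : ℤ) - 1)).eval t = 0 := by
        rw [hS, div_eq_zero_iff]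
        left
        have : (((k : ℤ) - 1 : ℤ) + 1 : ℝ) * (2 * (Real.pi / M i j)) = Real.pi := by
          have : ((M i j : ℕ) : ℝ) = 2 * k := by exact_mod_cast hk
          rw [this] at hpos ⊢
          have : (k : ℝ) ≠ 0 := by rintro h; simp [h] at hpos
          push_cast
          field_simp
          ring
        rw [this, Real.sin_pi]
      rw [h1, h2, h0]; simp
    · have h1 : (((M i j : ℕ) : ℤ) - 2) / 2 = k - 1 := by omega
      have h2 : (((M i j : ℕ) : ℤ) - 1) / 2 = k := by omega
      have h3' : (((M i j : ℕ) : ℤ) - 3) / 2 = k - 1 := by omega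
      have h4 : (((M i j : ℕ) : ℤ)) / 2 = k := by omega
      have h0 : (S ℝ (k : ℤ)).eval t + (S ℝ ((k : ℤ) - 1)).eval t = 0 := by
        rw [hS, hS, ← add_div, div_eq_zero_iff]
        left
        have hm : ((M i j : ℕ) : ℝ) = 2 * k + 1 := by exact_mod_cast hk
        have : (((k : ℤ) : ℝ) + 1) * (2 * (Real.pi / M i j)) =
            2 * Real.pi - (((k : ℤ) - 1 : ℤ) + 1 : ℝ) * (2 * (Real.pi / M i j)) := by
          rw [hm] at hpos ⊢
          push_cast
          field_simp
          ring
        rw [this, Real.sin_two_pi_sub]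
        ring
      rw [h1, h2, h3', h4, h0]; simp

/-- In a Coxeter group, `s_i s_j` has order exactly `M i j`. -/
theorem orderOf_simple_mul {B W : Type*} [Group W] {M : CoxeterMatrix B} (cs : CoxeterSystem M W)
    (i j : B) : orderOf (cs.simple i * cs.simple j) = M i j := by
  by_cases hij : i = j
  · subst hij; simp
  have hne : ∀ m : ℕ, 0 < m → (M i j = 0 ∨ m < M i j) → (cs.simple i * cs.simple j) ^ m ≠ 1 := by
    intro m hm0 hm h1
    have h2 := congrArg (cs.lift ⟨geomRefl M, geomRefl_liftable M⟩) h1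
    rw [map_pow, map_mul, cs.lift_apply_simple, cs.lift_apply_simple, map_one] at h2
    have h3 := DFunLike.congr_fun h2 (Finsupp.single i 1)
    set t := coroot M i (Finsupp.single j 1) * coroot M j (Finsupp.single i 1) - 2 with ht
    have ht' : t = 2 * Real.cos (2 * (Real.pi / M i j)) := by
      rw [ht, coroot_single, coroot_single, formCoeff_symm M j i, ← four_cos_sq]; rfl
    have h4 := (Module.reflection_mul_reflection_pow_apply_self (coroot_self M i) (coroot_self M j)
      m t ht).symm.trans h3
    rw [coroot_single, LinearEquiv.coe_one, id] at h4
    have hji : j ≠ i := Ne.symm hij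
    have h5 := DFunLike.congr_fun h4 i
    have h6 := DFunLike.congr_fun h4 j
    simp [hij, hji] at h5 h6
    rw [coroot_single] at h6
    have hM1 := M.off_diagonal i j hij
    have hMs := M.symmetric i j
    have hc : M i j ≠ 2 → formCoeff M j i ≠ 0 := by
      intro h2
      rw [formCoeff_symm]
      rcases Nat.eq_zero_or_pos (M i j) with h | h
      · simp [formCoeff, h]
      · have h3 : (3 : ℝ) ≤ M i j := by exact_mod_cast (by omega : 3 ≤ M i j)
        have : 0 < Real.cos (Real.pi / M i j) := by
          apply Real.cos_pos_of_mem_Ioo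
          constructor
          · have : 0 < Real.pi / M i j := by positivity
            linarith [Real.pi_pos]
          · rw [div_lt_div_iff₀ (by linarith) (by norm_num)]
            nlinarith [Real.pi_pos]
        simp [formCoeff, this.ne']
    rcases hm with hm | hm
    · have ht2 : t = 2 := by rw [ht', hm]; simp
      rw [ht2] at h6
      have := hc (by omega)
      simp [Polynomial.Chebyshev.S_eval_two, this] at h6
      omega
    · rcases Nat.lt_or_ge (M i j) 3 with h3 | h3
      · have hm1 : m = 1 := by omega
        have hM2 : M i j = 2 := by omega
        subst hm1
        have : t = -2 := by rw [ht', hM2]; simp [mul_div_cancel₀]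
        rw [this] at h5
        norm_num at h5
      · have hs := sin_two_pi_div_ne h3
        have hS : ∀ n : ℤ, (S ℝ n).eval t =
            Real.sin ((n + 1) * (2 * (Real.pi / M i j))) / Real.sin (2 * (Real.pi / M i j)) := by
          intro n
          rw [ht', eq_div_iff hs, S_two_mul_real_cos]
        have h7 := h6.resolve_right (hc (by omega))
        rw [h7, add_zero, hS, div_eq_one_iff_eq hs] at h5
        rw [hS, div_eq_zero_iff, or_iff_left hs] at h7
        push_cast at h5 h7
        rw [sub_add_cancel] at h7
        rw [add_mul, one_mul, Real.sin_add, h7, zero_mul, zero_add, mul_eq_right₀ hs] at h5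
        rw [Real.cos_eq_one_iff] at h5
        obtain ⟨n, hn⟩ := h5
        have hpos : (0 : ℝ) < M i j := by
          have : (3 : ℝ) ≤ M i j := by exact_mod_cast h3
          linarith
        have h8 : (n : ℝ) * M i j = m := by
          have := Real.pi_pos
          field_simp at hn
          linarith
        have h9 : n * (M i j : ℤ) = m := by exact_mod_cast h8
        have hn0 : 0 < n := by
          by_contra hn
          have : n * (M i j : ℤ) ≤ 0 := mul_nonpos_of_nonpos_of_nonneg (by omega) (by omega)
          omega
        have : (M i j : ℤ) ≤ m := by nlinarith
        omega
  rcases Nat.eq_zero_or_pos (M i j) with h | h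
  · rw [h, orderOf_eq_zero_iff']
    exact fun m hm => hne m hm (Or.inl h)
  · rw [orderOf_eq_iff h]
    exact ⟨cs.simple_mul_simple_pow i j, fun m hm h0 => hne m h0 (Or.inr hm)⟩

end Geometric

section Inversions

variable {B W : Type*} [Group W] {M : CoxeterMatrix B} (cs : CoxeterSystem M W)

open Classical in
/-- The action of a simple reflection on pairs (group element, sign). -/
noncomputable def signStep (i : B) : Function.End (W × ZMod 2) :=
  fun p => (cs.simple i * p.1 * cs.simple i, p.2 + if p.1 = cs.simple i then 1 else 0)

open Classical in
theorem signStep_pow (i j : B) (m : ℕ) (p : W × ZMod 2) :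
    ((signStep cs i * signStep cs j) ^ m) p =
      ((cs.simple i * cs.simple j) ^ m * p.1 * ((cs.simple i * cs.simple j) ^ m)⁻¹,
        p.2 + ∑ r ∈ Finset.range (2 * m),
          if p.1 = ((cs.simple i * cs.simple j)⁻¹) ^ r * cs.simple j then 1 else 0) := by
  induction m with
  | zero => simp; rfl
  | succ m ih =>
    have hconj : ∀ r : ℕ, cs.simple j * (cs.simple i * cs.simple j) ^ r =
        ((cs.simple i * cs.simple j)⁻¹) ^ r * cs.simple j := by
      intro r
      induction r with
      | zero => simp
      | succ r ih =>
        rw [pow_succ, ← mul_assoc, ih, pow_succ]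
        simp [mul_assoc]
    set q := cs.simple i * cs.simple j with hq
    have e1 : q ^ m * p.1 * (q ^ m)⁻¹ = cs.simple j ↔ p.1 = q⁻¹ ^ (2 * m) * cs.simple j := by
      rw [mul_inv_eq_iff_eq_mul, hconj, two_mul, pow_add, mul_assoc, inv_pow,
        ← eq_inv_mul_iff_mul_eq]
    have e2 : cs.simple j * (q ^ m * p.1 * (q ^ m)⁻¹) * cs.simple j = cs.simple i ↔
        p.1 = q⁻¹ ^ (2 * m + 1) * cs.simple j := by
      have hs : cs.simple j * cs.simple i * cs.simple j = q⁻¹ * cs.simple j := by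
        simp [hq]
      rw [← eq_mul_inv_iff_mul_eq, ← eq_inv_mul_iff_mul_eq, cs.inv_simple, ← mul_assoc, hs,
        mul_inv_eq_iff_eq_mul, mul_assoc, hconj, ← eq_inv_mul_iff_mul_eq, pow_succ,
        two_mul, pow_add, inv_pow]
      have hcomm : (q ^ m)⁻¹ * q⁻¹ = q⁻¹ * (q ^ m)⁻¹ := by
        rw [← mul_inv_rev, ← mul_inv_rev, pow_mul_comm']
      rw [mul_assoc _ _ q⁻¹, hcomm]
      simp only [mul_assoc]
    rw [pow_succ', show 2 * (m + 1) = 2 * m + 1 + 1 by ring, Finset.sum_range_succ,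
      Finset.sum_range_succ]
    change signStep cs i (signStep cs j (((signStep cs i * signStep cs j) ^ m) p)) = _
    rw [ih]
    simp only [signStep, e1, e2]
    refine Prod.ext ?_ ?_
    · simp [pow_succ', hq, mul_assoc]
    · simp [add_assoc]

open Classical in
theorem signStep_liftable : M.IsLiftable (signStep cs) := by
  intro i j
  funext p
  have h : ((cs.simple i * cs.simple j)⁻¹) ^ M i j = 1 := by simp
  have h' : ∀ r, ((cs.simple i * cs.simple j)⁻¹) ^ (M i j + r) =
      ((cs.simple i * cs.simple j)⁻¹) ^ r := fun r => by rw [pow_add, h, one_mul]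
  have key : (∑ r ∈ Finset.range (M i j + M i j),
      if p.1 = ((cs.simple i * cs.simple j)⁻¹) ^ r * cs.simple j then (1 : ZMod 2) else 0) = 0 := by
    rw [Finset.sum_range_add]
    simp_rw [h']
    exact CharTwo.add_self_eq_zero _
  refine (signStep_pow cs i j (M i j) p).trans ?_
  rw [two_mul, key]
  simp only [one_mul, cs.simple_mul_simple_pow, add_zero, inv_one, mul_one]
  rfl

open Classical in
theorem lift_signStep (ω : List B) (p : W × ZMod 2) :
    cs.lift ⟨signStep cs, signStep_liftable cs⟩ (cs.wordProd ω) p =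
      (cs.wordProd ω * p.1 * (cs.wordProd ω)⁻¹, p.2 + ((cs.rightInvSeq ω).count p.1 : ℕ)) := by
  induction ω with
  | nil => simp; rfl
  | cons i ω ih =>
    rw [cs.wordProd_cons, map_mul, cs.lift_apply_simple]
    change signStep cs i (cs.lift ⟨signStep cs, signStep_liftable cs⟩ (cs.wordProd ω) p) = _
    rw [ih, signStep, rightInvSeq, List.count_cons]
    refine Prod.ext ?_ ?_
    · simp [mul_assoc]
    · have : cs.wordProd ω * p.1 * (cs.wordProd ω)⁻¹ = cs.simple i ↔
          (cs.wordProd ω)⁻¹ * cs.simple i * cs.wordProd ω = p.1 := by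
        constructor
        · intro h; rw [← h]; group
        · intro h; rw [← h]; group
      simp only [this, beq_iff_eq, Nat.cast_add, Nat.cast_ite, Nat.cast_one, Nat.cast_zero,
        add_assoc]

theorem mem_rightInvSeq_of_wordProd_eq {ω ω' : List B} (h : cs.wordProd ω = cs.wordProd ω')
    (hn : (cs.rightInvSeq ω).Nodup) {t : W} (ht : t ∈ cs.rightInvSeq ω) :
    t ∈ cs.rightInvSeq ω' := by
  classical
  have h1 := lift_signStep cs ω (t, 0)
  rw [h, lift_signStep] at h1
  have h2 := congrArg Prod.snd h1
  simp only [List.count_eq_one_of_mem hn ht] at h2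
  by_contra hc
  rw [List.count_eq_zero_of_not_mem hc] at h2
  simp at h2

theorem isReduced_of_nodup {ω : List B} (hn : (cs.rightInvSeq ω).Nodup) : cs.IsReduced ω := by
  obtain ⟨ω', hr, h⟩ := cs.exists_isReduced (cs.wordProd ω)
  have h1 : (cs.rightInvSeq ω).Subperm (cs.rightInvSeq ω') :=
    List.subperm_of_subset hn fun t ht => mem_rightInvSeq_of_wordProd_eq cs h hn ht
  have h2 := h1.length_le
  rw [cs.length_rightInvSeq, cs.length_rightInvSeq, ← hr.eq, ← h] at h2
  exact le_antisymm (cs.length_wordProd_le ω) h2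

/-- The exchange condition. -/
theorem exchange {ω : List B} {i : B} (h : cs.IsRightDescent (cs.wordProd ω) i) :
    ∃ k < ω.length, cs.wordProd ω * cs.simple i = cs.wordProd (ω.eraseIdx k) := by
  obtain ⟨ω', hr, h'⟩ := cs.exists_isReduced (cs.wordProd ω * cs.simple i)
  have hw : cs.wordProd (ω'.concat i) = cs.wordProd ω := by
    rw [cs.wordProd_concat, ← h']; simp
  have hr' : cs.IsReduced (ω'.concat i) := by
    have := (cs.isRightDescent_iff).1 h
    unfold CoxeterSystem.IsReduced
    rw [hw, ← this, h', hr.eq]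
    simp
  have hmem := mem_rightInvSeq_of_wordProd_eq cs hw hr'.nodup_rightInvSeq
    (t := cs.simple i) (by rw [cs.rightInvSeq_concat]; simp)
  obtain ⟨k, hk, hk'⟩ := List.getElem_of_mem hmem
  refine ⟨k, by simpa using hk, ?_⟩
  rw [← cs.wordProd_mul_getD_rightInvSeq, List.getD_eq_getElem _ _ hk, hk']

theorem rightInvSeq_alternatingWord (i j : B) (m : ℕ) :
    cs.rightInvSeq (alternatingWord i j m) =
      (List.range m).reverse.map fun r => (cs.simple j * cs.simple i) ^ r * cs.simple j := by
  induction m generalizing i j with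
  | zero => simp [alternatingWord]
  | succ m ih =>
    rw [alternatingWord_succ, cs.rightInvSeq_concat, ih, List.range_succ_eq_map,
      List.reverse_cons, List.map_append, List.concat_eq_append, List.map_map]
    congr 1
    · rw [← List.map_reverse, List.map_map]
      apply List.map_congr_left
      intro r _
      simp only [Function.comp, MulAut.conj_apply, cs.inv_simple]
      have : cs.simple j * (cs.simple i * cs.simple j) ^ r * cs.simple i =
          (cs.simple j * cs.simple i) ^ (r + 1) := by
        rw [← mul_pow_mul]
        rw [pow_succ, mul_assoc]
      rw [← this]; simp [mul_assoc]
    · simp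

theorem isReduced_braidWord (i j : B) : cs.IsReduced (braidWord M i j) := by
  apply isReduced_of_nodup
  rw [rightInvSeq_alternatingWord]
  apply List.Nodup.map_on
  · intro a ha b hb hab
    simp only [List.mem_reverse, List.mem_range] at ha hb
    rw [mul_left_inj] at hab
    have ho := orderOf_simple_mul cs j i
    rw [M.symmetric] at ho
    exact pow_injOn_Iio_orderOf (by simpa [ho] using ha) (by simpa [ho] using hb) hab
  · rw [List.nodup_reverse]; exact List.nodup_range

end Inversions

section Demazure

variable {B W : Type*} [Group W] {M : CoxeterMatrix B} (cs : CoxeterSystem M W)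

open Classical in
/-- `s * w` if this is longer than `w`, and `w` otherwise. -/
noncomputable def leftUp (i : B) (w : W) : W :=
  if cs.IsLeftDescent w i then w else cs.simple i * w

open Classical in
/-- `w * s` if this is longer than `w`, and `w` otherwise. -/
noncomputable def rightUp (j : B) (w : W) : W :=
  if cs.IsRightDescent w j then w else w * cs.simple j

theorem simple_mul_eq_mul_simple {i j : B} {w : W} (hi : ¬ cs.IsLeftDescent w i)
    (h : cs.IsRightDescent (cs.simple i * w) j) (hj : ¬ cs.IsRightDescent w j) :
    cs.simple i * w = w * cs.simple j := by
  obtain ⟨ω, hr, rfl⟩ := cs.exists_isReduced w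
  rw [← cs.wordProd_cons] at h
  obtain ⟨k, hk, hk'⟩ := exchange cs h
  rcases k with _ | k
  · rw [List.eraseIdx_cons_zero, cs.wordProd_cons] at hk'
    nth_rw 2 [← hk']; simp
  · exfalso
    rw [List.eraseIdx_cons_succ, cs.wordProd_cons, cs.wordProd_cons, mul_assoc,
      mul_right_inj] at hk'
    have h1 := cs.length_wordProd_le (ω.eraseIdx k)
    rw [← hk', List.length_eraseIdx_of_lt (by simpa using hk)] at h1
    have h2 := (cs.not_isRightDescent_iff).1 hj
    have h3 := hr.eq
    omega

theorem leftUp_rightUp (i j : B) (w : W) :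
    leftUp cs i (rightUp cs j w) = rightUp cs j (leftUp cs i w) := by
  by_cases hi : cs.IsLeftDescent w i <;> by_cases hj : cs.IsRightDescent w j
  · simp [leftUp, rightUp, hi, hj]
  · have h : cs.IsLeftDescent (w * cs.simple j) i := by
      have h1 := (cs.not_isRightDescent_iff).1 hj
      have h2 := (cs.isLeftDescent_iff).1 hi
      have h3 := cs.length_mul_le (cs.simple i * w) (cs.simple j)
      rw [cs.length_simple, mul_assoc] at h3
      unfold CoxeterSystem.IsLeftDescent
      omega
    simp [leftUp, rightUp, hi, hj, h]
  · have h : cs.IsRightDescent (cs.simple i * w) j := by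
      have h1 := (cs.isRightDescent_iff).1 hj
      have h2 := (cs.not_isLeftDescent_iff).1 hi
      have h3 := cs.length_mul_le (cs.simple i) (w * cs.simple j)
      rw [cs.length_simple, ← mul_assoc] at h3
      unfold CoxeterSystem.IsRightDescent
      omega
    simp [leftUp, rightUp, hi, hj, h]
  · have h1 := (cs.not_isRightDescent_iff).1 hj
    have h2 := (cs.not_isLeftDescent_iff).1 hi
    have h3 : cs.IsLeftDescent (w * cs.simple j) i ↔ cs.IsRightDescent (cs.simple i * w) j := by
      unfold CoxeterSystem.IsLeftDescent CoxeterSystem.IsRightDescent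
      rw [mul_assoc, h1, h2]
    by_cases h : cs.IsRightDescent (cs.simple i * w) j
    · simp only [leftUp, rightUp, hi, hj, if_false, h3.2 h, h, if_true]
      exact (simple_mul_eq_mul_simple cs hi h hj).symm
    · simp only [leftUp, rightUp, hi, hj, if_false, mt h3.1 h, h, mul_assoc]

theorem foldr_rightUp (j : B) (w : W) (ω : List B) :
    ω.foldr (leftUp cs) (rightUp cs j w) = rightUp cs j (ω.foldr (leftUp cs) w) := by
  induction ω with
  | nil => rfl
  | cons i ω ih => rw [List.foldr_cons, ih, leftUp_rightUp, List.foldr_cons]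

theorem rightUp_induction {P : W → Prop} (one : P 1) (step : ∀ j w, P w → P (rightUp cs j w))
    (w : W) : P w := by
  induction hn : cs.length w using Nat.strong_induction_on generalizing w with
  | _ n ih =>
    by_cases hw : w = 1
    · rw [hw]; exact one
    · obtain ⟨j, hj⟩ := cs.exists_rightDescent_of_ne_one hw
      have h2 : ¬ cs.IsRightDescent (w * cs.simple j) j := by
        unfold CoxeterSystem.IsRightDescent at hj ⊢
        rw [cs.simple_mul_simple_cancel_right]
        omega
      have h1 : w = rightUp cs j (w * cs.simple j) := by simp [rightUp, h2]
      rw [h1]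
      exact step j _ (ih _ (hn ▸ hj) _ rfl)

theorem foldr_leftUp_one {ω : List B} (h : cs.IsReduced ω) :
    ω.foldr (leftUp cs) 1 = cs.wordProd ω := by
  induction ω with
  | nil => simp
  | cons i ω ih =>
    have h' : cs.IsReduced ω := by simpa using h.drop 1
    have h1 : ¬ cs.IsLeftDescent (cs.wordProd ω) i := by
      unfold CoxeterSystem.IsLeftDescent
      rw [← cs.wordProd_cons, h.eq, h'.eq]
      simp
    rw [List.foldr_cons, ih h', leftUp, if_neg h1, cs.wordProd_cons]

theorem foldr_leftUp_braidWord (i j : B) (w : W) :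
    (braidWord M i j).foldr (leftUp cs) w = (braidWord M j i).foldr (leftUp cs) w := by
  induction w using rightUp_induction cs with
  | one =>
    rw [foldr_leftUp_one cs (isReduced_braidWord cs i j),
      foldr_leftUp_one cs (isReduced_braidWord cs j i), cs.wordProd_braidWord_eq]
  | step k w ih => rw [foldr_rightUp, foldr_rightUp, ih]

end Demazure

section Longest

variable {B W : Type*} [Group W] {M : CoxeterMatrix B} (cs : CoxeterSystem M W)

theorem exists_longest [Finite W] : ∃ w : W, ∀ x, cs.length x ≤ cs.length w :=
  Finite.exists_max cs.length

/-- The longest element of a finite Coxeter group. -/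
noncomputable def longest [Finite W] : W := (exists_longest cs).choose

variable [Finite W]

theorem length_le_longest (x : W) : cs.length x ≤ cs.length (longest cs) :=
  (exists_longest cs).choose_spec x

theorem foldr_leftUp_longest (ω : List B) :
    ω.foldr (leftUp cs) (longest cs) = longest cs := by
  induction ω with
  | nil => rfl
  | cons i ω ih =>
    have h : cs.IsLeftDescent (longest cs) i := by
      by_contra h
      have h1 := (cs.not_isLeftDescent_iff).1 h
      have h2 := length_le_longest cs (cs.simple i * longest cs)
      omega
    rw [List.foldr_cons, ih, leftUp, if_pos h]

theorem exists_mul_eq_longest (w : W) :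
    ∃ x, longest cs = w * x ∧ cs.length (longest cs) = cs.length w + cs.length x := by
  obtain ⟨ω, hr, rfl⟩ := cs.exists_isReduced w
  have key : ∀ z : W, ∃ x, ω.foldr (leftUp cs) z = cs.wordProd ω * x ∧
      cs.length (ω.foldr (leftUp cs) z) = cs.length (cs.wordProd ω) + cs.length x := by
    intro z
    induction z using rightUp_induction cs with
    | one => exact ⟨1, by simp [foldr_leftUp_one cs hr]⟩
    | step j z ih =>
      obtain ⟨x, h1, h2⟩ := ih
      rw [foldr_rightUp, rightUp]
      split_ifs with hd
      · exact ⟨x, h1, h2⟩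
      · have h3 := (cs.not_isRightDescent_iff).1 hd
        refine ⟨x * cs.simple j, by rw [h1, mul_assoc], ?_⟩
        have h4 := cs.length_mul_le (cs.wordProd ω) (x * cs.simple j)
        rw [← mul_assoc, ← h1] at h4
        have h5 := cs.length_mul_le x (cs.simple j)
        rw [cs.length_simple] at h5
        omega
  have := key (longest cs)
  rwa [foldr_leftUp_longest] at this

theorem length_mul_longest (w : W) :
    cs.length (w * longest cs) + cs.length w = cs.length (longest cs) := by
  obtain ⟨x, h1, h2⟩ := exists_mul_eq_longest cs w⁻¹
  rw [cs.length_inv] at h2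
  have : w * longest cs = x := by rw [h1]; simp
  rw [this, h2, add_comm]

theorem longest_mul_self : longest cs * longest cs = 1 := by
  rw [← cs.length_eq_zero_iff]
  have := length_mul_longest cs (longest cs)
  omega

theorem longest_inv : (longest cs)⁻¹ = longest cs :=
  inv_eq_of_mul_eq_one_left (longest_mul_self cs)

theorem length_longest_mul (w : W) :
    cs.length (longest cs * w) + cs.length w = cs.length (longest cs) := by
  have := length_mul_longest cs w⁻¹
  rwa [← cs.length_inv, cs.length_inv w, mul_inv_rev, inv_inv, longest_inv] at this

theorem exists_simple_eq_conj (i : B) :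
    ∃ j, cs.simple j = longest cs * cs.simple i * longest cs := by
  have h1 := length_mul_longest cs (longest cs * cs.simple i)
  have h2 := length_longest_mul cs (cs.simple i)
  rw [cs.length_simple] at h2
  obtain ⟨j, hj⟩ := (cs.length_eq_one_iff).1
    (show cs.length (longest cs * cs.simple i * longest cs) = 1 by omega)
  exact ⟨j, hj.symm⟩

/-- The permutation of the simple reflections given by conjugation with the longest element. -/
noncomputable def conjIndex (i : B) : B := (exists_simple_eq_conj cs i).choose

theorem simple_conjIndex (i : B) :
    cs.simple (conjIndex cs i) = longest cs * cs.simple i * longest cs :=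
  (exists_simple_eq_conj cs i).choose_spec

theorem matrix_conjIndex (i j : B) : M (conjIndex cs i) (conjIndex cs j) = M i j := by
  rw [← orderOf_simple_mul cs, ← orderOf_simple_mul cs, simple_conjIndex, simple_conjIndex]
  have : longest cs * cs.simple i * longest cs * (longest cs * cs.simple j * longest cs) =
      MulAut.conj (longest cs) (cs.simple i * cs.simple j) := by
    rw [MulAut.conj_apply, longest_inv]
    simp only [mul_assoc]
    rw [← mul_assoc (longest cs) (longest cs), longest_mul_self, one_mul]
  rw [this]
  exact MulEquiv.orderOf_eq (MulAut.conj (longest cs)) _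

end Longest

section Algebra

variable (𝕜 : Type*) [Field 𝕜] {B : Type*} (M : CoxeterMatrix B)

/-- The defining relations of the 0-Hecke algebra: `π_s ^ 2 = π_s`, and the braid relations
`(π_s π_t)_{m(s,t)} = (π_t π_s)_{m(s,t)}` between the two alternating products with `m(s,t)`
factors. (The latter holds trivially if `s = t`, and if `m(s,t) = ∞`, which is encoded as `0`
and does not occur in finite Coxeter groups.) -/
inductive HeckeRel : FreeAlgebra 𝕜 B → FreeAlgebra 𝕜 B → Prop
  | idem (i : B) : HeckeRel (FreeAlgebra.ι 𝕜 i * FreeAlgebra.ι 𝕜 i) (FreeAlgebra.ι 𝕜 i)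
  | braid (i j : B) :
      HeckeRel ((braidWord M i j).map (FreeAlgebra.ι 𝕜)).prod
        ((braidWord M j i).map (FreeAlgebra.ι 𝕜)).prod

/-- The 0-Hecke algebra `H_W(0)` over `𝕜` of the Coxeter group with Coxeter matrix `M`. -/
abbrev HeckeAlgebra : Type _ := RingQuot (HeckeRel 𝕜 M)

variable {M}

/-- The generator `π_s`. -/
noncomputable def heckeGen (i : B) : HeckeAlgebra 𝕜 M :=
  RingQuot.mkAlgHom 𝕜 (HeckeRel 𝕜 M) (FreeAlgebra.ι 𝕜 i)

variable {𝕜}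

theorem prod_map_algHom {A A' : Type*} [Ring A] [Ring A'] [Algebra 𝕜 A] [Algebra 𝕜 A']
    (F : A →ₐ[𝕜] A') (g : B → A) (ω : List B) :
    F (ω.map g).prod = (ω.map fun i => F (g i)).prod := by
  rw [map_list_prod, List.map_map]; rfl

theorem heckeGen_mul_self (i : B) : heckeGen 𝕜 (M := M) i * heckeGen 𝕜 i = heckeGen 𝕜 i := by
  have := RingQuot.mkAlgHom_rel 𝕜 (HeckeRel.idem (𝕜 := 𝕜) (M := M) i)
  rwa [map_mul] at this

theorem heckeGen_braid (i j : B) :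
    ((braidWord M i j).map (heckeGen 𝕜 (M := M))).prod = ((braidWord M j i).map (heckeGen 𝕜)).prod := by
  have := RingQuot.mkAlgHom_rel 𝕜 (HeckeRel.braid (𝕜 := 𝕜) (M := M) i j)
  rwa [prod_map_algHom, prod_map_algHom] at this

/-- The universal property of the 0-Hecke algebra. -/
noncomputable def liftHecke {A : Type*} [Ring A] [Algebra 𝕜 A] (f : B → A)
    (idem : ∀ i, f i * f i = f i)
    (braid : ∀ i j, ((braidWord M i j).map f).prod = ((braidWord M j i).map f).prod) :
    HeckeAlgebra 𝕜 M →ₐ[𝕜] A :=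
  RingQuot.liftAlgHom 𝕜 ⟨FreeAlgebra.lift 𝕜 f, by
    rintro _ _ (i | ⟨i, j⟩)
    · simp [idem]
    · simp only [prod_map_algHom, FreeAlgebra.lift_ι_apply]
      exact braid i j⟩

theorem liftHecke_heckeGen {A : Type*} [Ring A] [Algebra 𝕜 A] (f : B → A)
    (idem : ∀ i, f i * f i = f i)
    (braid : ∀ i j, ((braidWord M i j).map f).prod = ((braidWord M j i).map f).prod) (i : B) :
    liftHecke (𝕜 := 𝕜) f idem braid (heckeGen 𝕜 i) = f i := by
  simp [liftHecke, heckeGen]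

theorem adjoin_range_heckeGen : Algebra.adjoin 𝕜 (Set.range (heckeGen 𝕜 (M := M))) = ⊤ := by
  have h : Set.range (heckeGen 𝕜 (M := M)) =
      RingQuot.mkAlgHom 𝕜 (HeckeRel 𝕜 M) '' Set.range (FreeAlgebra.ι 𝕜) := by
    rw [← Set.range_comp]; rfl
  rw [h, ← AlgHom.map_adjoin, FreeAlgebra.adjoin_range_ι, Algebra.map_top,
    AlgHom.range_eq_top]
  exact RingQuot.mkAlgHom_surjective 𝕜 _

theorem map_alternatingWord {B' : Type*} (g : B → B') (i j : B) (m : ℕ) :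
    (alternatingWord i j m).map g = alternatingWord (g i) (g j) m := by
  induction m generalizing i j with
  | zero => rfl
  | succ m ih => rw [alternatingWord_succ, alternatingWord_succ, List.concat_eq_append,
      List.map_append, ih, List.concat_eq_append]; rfl

theorem reverse_alternatingWord (i j : B) (m : ℕ) :
    (alternatingWord i j m).reverse =
      if Even m then alternatingWord j i m else alternatingWord i j m := by
  induction m generalizing i j with
  | zero => simp [alternatingWord]
  | succ m ih =>
    rw [alternatingWord_succ, List.concat_eq_append, List.reverse_append, ih,
      List.reverse_singleton, List.singleton_append, ← List.concat_eq_append,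
      ← alternatingWord_succ]
    by_cases h : Even m
    · have h' : ¬ Even (m + 1) := by simpa [Nat.even_add_one] using h
      rw [if_pos h, if_neg h', alternatingWord_succ', if_pos h]
    · have h' : Even (m + 1) := by simpa [Nat.even_add_one] using h
      rw [if_neg h, if_pos h', alternatingWord_succ', if_neg h]

section
variable {A : Type*} [Ring A]

/-- The alternating product of `a` and `b` with `k` factors, the last of which is `b`. -/
def altProd (a b : A) : ℕ → A
  | 0 => 1
  | k + 1 => altProd b a k * b

theorem prod_map_alternatingWord (f : B → A) (i j : B) (k : ℕ) :
    ((alternatingWord i j k).map f).prod = altProd (f i) (f j) k := by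
  induction k generalizing i j with
  | zero => rfl
  | succ k ih => simp [alternatingWord_succ, altProd, ih]

theorem altProd_one_sub {a b : A} (ha : a * a = a) (hb : b * b = b) (k : ℕ) :
    ∃ D : A, altProd (a - 1) (b - 1) (k + 1) = altProd a b (k + 1) + D ∧
      altProd (b - 1) (a - 1) (k + 1) = altProd b a (k + 1) + D ∧
      D * b = - altProd a b (k + 1) ∧ D * a = - altProd b a (k + 1) := by
  induction k with
  | zero => exact ⟨-1, by simp [altProd]; abel, by simp [altProd]; abel, by simp [altProd],
      by simp [altProd]⟩
  | succ k ih =>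
    obtain ⟨D, h1, h2, h3, h4⟩ := ih
    have pa : altProd b a (k + 1) * a = altProd b a (k + 1) := by
      simp only [altProd, mul_assoc, ha]
    have pb : altProd a b (k + 1) * b = altProd a b (k + 1) := by
      simp only [altProd, mul_assoc, hb]
    refine ⟨-(altProd a b (k + 1) + altProd b a (k + 1)) - D, ?_, ?_, ?_, ?_⟩
    · rw [altProd.eq_2 (a - 1), h2, altProd.eq_2 a b (k + 1), mul_sub, add_mul, h3, mul_one]; abel
    · rw [altProd.eq_2 (b - 1), h1, altProd.eq_2 b a (k + 1), mul_sub, add_mul, h4, mul_one]; abel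
    · rw [sub_mul, neg_mul, add_mul, h3, pb, altProd.eq_2 a b (k + 1)]; abel
    · rw [sub_mul, neg_mul, add_mul, h4, pa, altProd.eq_2 b a (k + 1)]; abel

theorem altProd_neg (a b : A) (k : ℕ) : altProd (-a) (-b) k = (-1) ^ k * altProd a b k := by
  induction k generalizing a b with
  | zero => simp [altProd]
  | succ k ih => simp [altProd, ih, pow_succ, mul_assoc]

theorem altProd_one_sub_comm {a b : A} (ha : a * a = a) (hb : b * b = b) {k : ℕ}
    (h : altProd a b k = altProd b a k) :
    altProd (1 - a) (1 - b) k = altProd (1 - b) (1 - a) k := by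
  cases k with
  | zero => rfl
  | succ k =>
    obtain ⟨D, h1, h2, -, -⟩ := altProd_one_sub ha hb k
    rw [← neg_sub a 1, ← neg_sub b 1, altProd_neg, altProd_neg, h1, h2, h]

end

variable (𝕜)

/-- The involution `θ : π_s ↦ 1 - π_s` of the 0-Hecke algebra. -/
noncomputable def theta (M : CoxeterMatrix B) : HeckeAlgebra 𝕜 M →ₐ[𝕜] HeckeAlgebra 𝕜 M :=
  liftHecke (fun i => 1 - heckeGen 𝕜 i)
    (fun i => by rw [mul_sub, sub_mul, sub_mul, heckeGen_mul_self]; simp)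
    (fun i j => by
      have h := heckeGen_braid (𝕜 := 𝕜) (M := M) i j
      rw [braidWord, braidWord, M.symmetric j i, prod_map_alternatingWord,
        prod_map_alternatingWord] at h ⊢
      exact altProd_one_sub_comm (heckeGen_mul_self i) (heckeGen_mul_self j) h)

/-- The anti-involution `χ : π_s ↦ π_s` of the 0-Hecke algebra, as a homomorphism to the
opposite algebra. -/
noncomputable def chi (M : CoxeterMatrix B) : HeckeAlgebra 𝕜 M →ₐ[𝕜] (HeckeAlgebra 𝕜 M)ᵐᵒᵖ :=
  liftHecke (fun i => MulOpposite.op (heckeGen 𝕜 i))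
    (fun i => by rw [← MulOpposite.op_mul, heckeGen_mul_self])
    (fun i j => by
      have key : ∀ ω : List B, (ω.map fun i => MulOpposite.op (heckeGen 𝕜 (M := M) i)).prod =
          MulOpposite.op (ω.reverse.map (heckeGen 𝕜)).prod := by
        intro ω
        rw [MulOpposite.op_list_prod, List.map_map, List.map_reverse, List.reverse_reverse]
        rfl
      have h := heckeGen_braid (𝕜 := 𝕜) (M := M) i j
      rw [key, key, braidWord, braidWord, M.symmetric j i] at *
      rw [reverse_alternatingWord, reverse_alternatingWord]
      split_ifs
      · rw [h]
      · rw [h])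

/-- The involution `φ : π_s ↦ π_{w₀ s w₀}` of the 0-Hecke algebra of a finite Coxeter group. -/
noncomputable def phi {W : Type*} [Group W] [Finite W] (cs : CoxeterSystem M W) :
    HeckeAlgebra 𝕜 M →ₐ[𝕜] HeckeAlgebra 𝕜 M :=
  liftHecke (fun i => heckeGen 𝕜 (conjIndex cs i)) (fun i => heckeGen_mul_self _)
    (fun i j => by
      have h := heckeGen_braid (𝕜 := 𝕜) (M := M) (conjIndex cs i) (conjIndex cs j)
      have key : ∀ i j, (braidWord M i j).map (fun i => heckeGen 𝕜 (M := M) (conjIndex cs i)) =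
          (braidWord M (conjIndex cs i) (conjIndex cs j)).map (heckeGen 𝕜) := by
        intro i j
        rw [braidWord, braidWord, matrix_conjIndex, ← map_alternatingWord, List.map_map]
        rfl
      rw [key, key, h])

end Algebra

section Functors

variable {𝕜 : Type*} [Field 𝕜] {B : Type*} {M : CoxeterMatrix B}

/-- The twist `α[V]` of an `H_W(0)`-module `V` by an endomorphism `α` of `H_W(0)`:
the same space, with the action `a • v = α(a) v`. -/
def Twist (_α : HeckeAlgebra 𝕜 M →ₐ[𝕜] HeckeAlgebra 𝕜 M) (V : Type*) : Type _ := V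

/-- The module `χ[V]`: the dual space of `V`, with the action `(a • f)(v) = f(χ(a) v)`. -/
def ChiDual (𝕜 : Type*) [Field 𝕜] {B : Type*} (_M : CoxeterMatrix B)
    (V : Type*) [AddCommGroup V] [Module 𝕜 V] : Type _ := Module.Dual 𝕜 V

variable (α : HeckeAlgebra 𝕜 M →ₐ[𝕜] HeckeAlgebra 𝕜 M) (V : Type*) [AddCommGroup V] [Module 𝕜 V]

instance : AddCommGroup (Twist α V) := inferInstanceAs (AddCommGroup V)

instance : Module 𝕜 (Twist α V) := inferInstanceAs (Module 𝕜 V)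

instance : AddCommGroup (ChiDual 𝕜 M V) := inferInstanceAs (AddCommGroup (Module.Dual 𝕜 V))

instance : Module 𝕜 (ChiDual 𝕜 M V) := inferInstanceAs (Module 𝕜 (Module.Dual 𝕜 V))

/-- The identification of the underlying spaces of `V` and `α[V]`. -/
def Twist.of : V ≃ₗ[𝕜] Twist α V := LinearEquiv.refl 𝕜 V

/-- The identification of the underlying spaces of the dual of `V` and `χ[V]`. -/
def ChiDual.of (𝕜 : Type*) [Field 𝕜] {B : Type*} (M : CoxeterMatrix B)
    (V : Type*) [AddCommGroup V] [Module 𝕜 V] : Module.Dual 𝕜 V ≃ₗ[𝕜] ChiDual 𝕜 M V :=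
  LinearEquiv.refl 𝕜 _

variable {V} in
theorem ChiDual.ext {f g : ChiDual 𝕜 M V}
    (h : ∀ v, (ChiDual.of 𝕜 M V).symm f v = (ChiDual.of 𝕜 M V).symm g v) : f = g :=
  (ChiDual.of 𝕜 M V).symm.injective (LinearMap.ext h)

variable [Module (HeckeAlgebra 𝕜 M) V]

noncomputable instance : Module (HeckeAlgebra 𝕜 M) (Twist α V) :=
  Module.compHom V α.toRingHom

theorem Twist.smul_of (a : HeckeAlgebra 𝕜 M) (v : V) :
    a • Twist.of α V v = Twist.of α V (α a • v) := rfl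

variable [IsScalarTower 𝕜 (HeckeAlgebra 𝕜 M) V]

instance : IsScalarTower 𝕜 (HeckeAlgebra 𝕜 M) (Twist α V) where
  smul_assoc c a v := by
    obtain ⟨v, rfl⟩ := (Twist.of α V).surjective v
    rw [Twist.smul_of, Twist.smul_of, map_smul α, smul_assoc, map_smul]

noncomputable instance : SMul (HeckeAlgebra 𝕜 M) (ChiDual 𝕜 M V) where
  smul a f := ChiDual.of 𝕜 M V
    ((ChiDual.of 𝕜 M V).symm f ∘ₗ Algebra.lsmul 𝕜 𝕜 V (MulOpposite.unop (chi 𝕜 M a)))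

theorem ChiDual.smul_apply (a : HeckeAlgebra 𝕜 M) (f : ChiDual 𝕜 M V) (v : V) :
    (ChiDual.of 𝕜 M V).symm (a • f) v =
      (ChiDual.of 𝕜 M V).symm f (MulOpposite.unop (chi 𝕜 M a) • v) := rfl

noncomputable instance : Module (HeckeAlgebra 𝕜 M) (ChiDual 𝕜 M V) where
  one_smul f := ChiDual.ext fun v => by
    rw [ChiDual.smul_apply, map_one, MulOpposite.unop_one, one_smul]
  mul_smul a b f := ChiDual.ext fun v => by
    rw [ChiDual.smul_apply, ChiDual.smul_apply, ChiDual.smul_apply, map_mul,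
      MulOpposite.unop_mul, mul_smul]
  smul_zero a := ChiDual.ext fun v => by rw [ChiDual.smul_apply, map_zero]; rfl
  smul_add a f g := ChiDual.ext fun v => by
    rw [ChiDual.smul_apply, map_add, map_add, LinearMap.add_apply, LinearMap.add_apply,
      ChiDual.smul_apply, ChiDual.smul_apply]
  add_smul a b f := ChiDual.ext fun v => by
    rw [ChiDual.smul_apply, map_add, MulOpposite.unop_add, add_smul, map_add, map_add,
      LinearMap.add_apply, ChiDual.smul_apply, ChiDual.smul_apply]
  zero_smul f := ChiDual.ext fun v => by
    rw [ChiDual.smul_apply, map_zero, MulOpposite.unop_zero, zero_smul, map_zero, map_zero,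
      LinearMap.zero_apply]

instance : IsScalarTower 𝕜 (HeckeAlgebra 𝕜 M) (ChiDual 𝕜 M V) where
  smul_assoc c a f := ChiDual.ext fun v => by
    rw [ChiDual.smul_apply, map_smul (chi 𝕜 M), MulOpposite.unop_smul, smul_assoc, LinearMap.map_smul,
      LinearEquiv.map_smul, LinearMap.smul_apply, ChiDual.smul_apply]

/-- The image `φ[V]` of `V`. -/
abbrev PhiTwist {W : Type*} [Group W] [Finite W] (cs : CoxeterSystem M W) (𝕜 : Type*) [Field 𝕜]
    (V : Type*) : Type _ :=
  Twist (phi 𝕜 cs) V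

/-- The image `θ[χ[V]]` of `V` under `θ ∘ χ`. -/
abbrev HatTheta (M : CoxeterMatrix B) (𝕜 : Type*) [Field 𝕜] (V : Type*) [AddCommGroup V]
    [Module 𝕜 V] : Type _ :=
  Twist (theta 𝕜 M) (ChiDual 𝕜 M V)

/-- The image `φ[θ[χ[V]]]` of `V` under `φ ∘ θ ∘ χ`. -/
abbrev HatOmega {W : Type*} [Group W] [Finite W] (cs : CoxeterSystem M W) (𝕜 : Type*) [Field 𝕜]
    (V : Type*) [AddCommGroup V] [Module 𝕜 V] : Type _ :=
  Twist (phi 𝕜 cs) (Twist (theta 𝕜 M) (ChiDual 𝕜 M V))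

end Functors

section Interval

variable {B W : Type*} [Group W] {M : CoxeterMatrix B} (cs : CoxeterSystem M W)

/-- The left weak Bruhat order: `v = s₁ ⋯ s_k u` with `ℓ(v) = ℓ(u) + k`. -/
def LeftWeakLE (u v : W) : Prop :=
  ∃ ω : List B, v = cs.wordProd ω * u ∧ cs.length v = cs.length u + ω.length

/-- The left weak Bruhat interval `[u, v]_L`. -/
def weakInterval (u v : W) : Set W := {w | LeftWeakLE cs u w ∧ LeftWeakLE cs w v}

/-- `Y` is an upper order ideal in the poset `[u, v]_L`. -/
structure IsUpperOrderIdeal (u v : W) (Y : Set W) : Prop where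
  subset : Y ⊆ weakInterval cs u v
  upper : ∀ x ∈ Y, ∀ y ∈ weakInterval cs u v, LeftWeakLE cs x y → y ∈ Y

theorem LeftWeakLE.refl (u : W) : LeftWeakLE cs u u := ⟨[], by simp⟩

variable {cs}

theorem LeftWeakLE.trans {u v w : W} (h : LeftWeakLE cs u v) (h' : LeftWeakLE cs v w) :
    LeftWeakLE cs u w := by
  obtain ⟨ω, h1, h2⟩ := h
  obtain ⟨ω', h3, h4⟩ := h'
  refine ⟨ω' ++ ω, ?_, ?_⟩
  · rw [h3, h1, cs.wordProd_append, mul_assoc]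
  · rw [h4, h2, List.length_append]; omega

theorem leftWeakLE_simple_mul {w : W} {i : B} (h : ¬ cs.IsLeftDescent w i) :
    LeftWeakLE cs w (cs.simple i * w) :=
  ⟨[i], by simp, by rw [(cs.not_isLeftDescent_iff).1 h]; rfl⟩

variable (cs)

theorem leftWeakLE_leftUp (i : B) (w : W) : LeftWeakLE cs w (leftUp cs i w) := by
  unfold leftUp
  split_ifs with h
  · exact LeftWeakLE.refl cs w
  · exact leftWeakLE_simple_mul h

theorem leftWeakLE_foldr (ω : List B) (w : W) : LeftWeakLE cs w (ω.foldr (leftUp cs) w) := by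
  induction ω with
  | nil => exact LeftWeakLE.refl cs w
  | cons i ω ih => exact ih.trans (leftWeakLE_leftUp cs i _)

variable (𝕜 : Type*) [Field 𝕜] (u v : W)

/-- The underlying space of the weak Bruhat interval module `B(u, v)`, with basis `[u, v]_L`. -/
def IntervalModule : Type _ := weakInterval cs u v →₀ 𝕜

noncomputable instance : AddCommGroup (IntervalModule cs 𝕜 u v) :=
  inferInstanceAs (AddCommGroup (weakInterval cs u v →₀ 𝕜))

noncomputable instance : Module 𝕜 (IntervalModule cs 𝕜 u v) :=
  inferInstanceAs (Module 𝕜 (weakInterval cs u v →₀ 𝕜))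

/-- The basis `[u, v]_L` of `B(u, v)`. -/
noncomputable def intervalBasis : Module.Basis (weakInterval cs u v) 𝕜 (IntervalModule cs 𝕜 u v) :=
  ⟨LinearEquiv.refl 𝕜 _⟩

open Classical in
/-- The basis element `w` of `B(u, v)` if `w ∈ [u, v]_L`, and `0` otherwise. -/
noncomputable def basisOrZero (w : W) : IntervalModule cs 𝕜 u v :=
  if h : w ∈ weakInterval cs u v then intervalBasis cs 𝕜 u v ⟨w, h⟩ else 0

open Classical in
/-- The action of `π_s` on `B(u, v)`: a basis element `w` is fixed if `s` is a left descent of `w`;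
otherwise it is sent to `s w` if `s w ∈ [u, v]_L`, and to `0` if not. -/
noncomputable def intervalOp (i : B) : Module.End 𝕜 (IntervalModule cs 𝕜 u v) :=
  (intervalBasis cs 𝕜 u v).constr 𝕜 fun w =>
    if cs.IsLeftDescent w i then intervalBasis cs 𝕜 u v w
    else basisOrZero cs 𝕜 u v (cs.simple i * w)

theorem intervalOp_basis (i : B) (w : weakInterval cs u v) :
    intervalOp cs 𝕜 u v i (intervalBasis cs 𝕜 u v w) = basisOrZero cs 𝕜 u v (leftUp cs i w) := by
  rw [intervalOp, Module.Basis.constr_basis]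
  by_cases hd : cs.IsLeftDescent (w : W) i
  · simp [leftUp, hd, basisOrZero]
  · rw [if_neg hd, leftUp, if_neg hd]

theorem intervalOp_word (ω : List B) (w : weakInterval cs u v) :
    (ω.map (intervalOp cs 𝕜 u v)).prod (intervalBasis cs 𝕜 u v w) =
      basisOrZero cs 𝕜 u v (ω.foldr (leftUp cs) w) := by
  induction ω with
  | nil => simp [basisOrZero]
  | cons i ω ih =>
    rw [List.map_cons, List.prod_cons, Module.End.mul_apply, ih]
    by_cases h : ω.foldr (leftUp cs) w ∈ weakInterval cs u v
    · rw [basisOrZero, dif_pos h, intervalOp_basis]; rfl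
    · have h' : (i :: ω).foldr (leftUp cs) w ∉ weakInterval cs u v := fun hc =>
        h ⟨w.2.1.trans (leftWeakLE_foldr cs ω w), (leftWeakLE_leftUp cs i _).trans hc.2⟩
      rw [basisOrZero, basisOrZero, dif_neg h, dif_neg h', map_zero]

/-- The representation of the 0-Hecke algebra on `B(u, v)`. -/
noncomputable def intervalRep :
    HeckeAlgebra 𝕜 M →ₐ[𝕜] Module.End 𝕜 (IntervalModule cs 𝕜 u v) :=
  liftHecke (intervalOp cs 𝕜 u v)
    (fun i => (intervalBasis cs 𝕜 u v).ext fun w => by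
      have h := intervalOp_word cs 𝕜 u v [i, i] w
      have h' := intervalOp_word cs 𝕜 u v [i] w
      have hu : leftUp cs i (leftUp cs i (w : W)) = leftUp cs i w := by
        by_cases hd : cs.IsLeftDescent (w : W) i
        · simp [leftUp, hd]
        · have : cs.IsLeftDescent (cs.simple i * (w : W)) i := by
            have := (cs.not_isLeftDescent_iff).1 hd
            unfold CoxeterSystem.IsLeftDescent
            rw [cs.simple_mul_simple_cancel_left]; omega
          simp [leftUp, hd, this]
      simp only [List.map_cons, List.map_nil, List.prod_cons, List.prod_nil, mul_one,
        List.foldr_cons, List.foldr_nil, hu] at h h'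
      rw [h, h'])
    (fun i j => (intervalBasis cs 𝕜 u v).ext fun w => by
      rw [intervalOp_word, intervalOp_word]
      rw [foldr_leftUp_braidWord cs i j])

noncomputable instance : Module (HeckeAlgebra 𝕜 M) (IntervalModule cs 𝕜 u v) :=
  Module.compHom _ (intervalRep cs 𝕜 u v).toRingHom

instance : IsScalarTower 𝕜 (HeckeAlgebra 𝕜 M) (IntervalModule cs 𝕜 u v) where
  smul_assoc c a x := by
    change intervalRep cs 𝕜 u v (c • a) x = c • intervalRep cs 𝕜 u v a x
    rw [map_smul, LinearMap.smul_apply]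

theorem heckeGen_smul (i : B) (x : IntervalModule cs 𝕜 u v) :
    heckeGen 𝕜 (M := M) i • x = intervalOp cs 𝕜 u v i x := by
  change intervalRep cs 𝕜 u v (heckeGen 𝕜 i) x = _
  rw [intervalRep, liftHecke_heckeGen]

variable {u v}

/-- The span of the basis elements of `B(u, v)` in a set `Y`, as a space. -/
noncomputable def spanSpace (u v : W) (Y : Set W) : Submodule 𝕜 (IntervalModule cs 𝕜 u v) :=
  Submodule.span 𝕜 (intervalBasis cs 𝕜 u v '' {w | (w : W) ∈ Y})

variable {cs}

/-- The submodule `𝕜Y` of `B(u, v)` spanned by an upper order ideal `Y` in `[u, v]_L`. -/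
noncomputable def idealSubmodule {Y : Set W} (hY : IsUpperOrderIdeal cs u v Y) :
    Submodule (HeckeAlgebra 𝕜 M) (IntervalModule cs 𝕜 u v) where
  carrier := spanSpace cs 𝕜 u v Y
  add_mem' := add_mem
  zero_mem' := zero_mem _
  smul_mem' a x hx := by
    have ha : a ∈ Algebra.adjoin 𝕜 (Set.range (heckeGen 𝕜 (M := M))) := by
      rw [adjoin_range_heckeGen]; trivial
    induction ha using Algebra.adjoin_induction generalizing x with
    | mem a ha =>
      obtain ⟨i, rfl⟩ := ha
      rw [heckeGen_smul]
      have hle : spanSpace cs 𝕜 u v Y ≤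
          (spanSpace cs 𝕜 u v Y).comap (intervalOp cs 𝕜 u v i) := by
        refine Submodule.span_le.2 ?_
        rintro _ ⟨w, hw, rfl⟩
        change intervalOp cs 𝕜 u v i (intervalBasis cs 𝕜 u v w) ∈ spanSpace cs 𝕜 u v Y
        rw [intervalOp_basis, basisOrZero]
        split_ifs with h
        · exact Submodule.subset_span
            ⟨_, hY.upper w hw _ h (leftWeakLE_leftUp cs i w), rfl⟩
        · exact zero_mem _
      exact hle hx
    | algebraMap c =>
      rw [algebraMap_smul]
      exact Submodule.smul_mem _ c hx
    | add a b _ _ iha ihb =>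
      rw [add_smul]
      exact add_mem (iha x hx) (ihb x hx)
    | mul a b _ _ iha ihb =>
      rw [mul_smul]
      exact iha _ (ihb x hx)

end Interval

end ZeroHecke

open ZeroHecke

/-! Everything rests on three permutations `τ` of the group: `w ↦ w₀ww₀`, `w ↦ ww₀` and `w ↦ w₀w`.
Since `ℓ(ww₀) = ℓ(w₀w) = ℓ(w₀) - ℓ(w)`, the first preserves left weak order and the other two
reverse it. Hence the first carries upper ideals to upper ideals, while under the others the
complement of the image of an upper ideal is again one. Let `σ` be the permutation of the generators
with `τ(s_{σ i} w) = s_i τ(w)`: it is `conjIndex` for the two maps with `w₀` on the left, and the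
identity for `w ↦ ww₀`.

Order-preserving case: on basis elements `π_i` acts as `leftUp`, truncated to `0` outside the
interval. As `τ` intertwines `leftUp` for `σ i` with `leftUp` for `i`, the map `w ↦ τ w` intertwines
`π_{σ i}` with `π_i`. It maps the span of `Y` onto that of `τ Y`, so it descends to the quotients
(`nonempty_twist_quotient_equiv`).

Order-reversing case: pair `B(τv, τu)` with `B(u, v)` by `⟨x, w⟩ = (-1)^ℓ(w)` if `x = τ w`, and `0`
otherwise. This pairing is perfect, and `π_i` on the left is adjoint to `1 - π_{σ i}` on the right
(`signedDelta_leftUp`, `intervalDualEquiv_intervalOp`). That adjunction is exactly the action on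
`θ[χ[-]]`, twisted further by `φ` when `σ` is `conjIndex`. The dual of `B(u, v)/𝕜Y` is the
annihilator of `𝕜Y`, which under the pairing is spanned by the complement of `τ Y`
(`mem_spanSpace_diff_iff`). Both dual isomorphisms are instances of `nonempty_dual_quotient_equiv`.
-/

namespace ZeroHecke

open CoxeterSystem

/-! ### Left weak order and descents under multiplication by the longest element -/

section WeakOrder

variable {B W : Type*} [Group W] {M : CoxeterMatrix B} {cs : CoxeterSystem M W}

/-- The word in the definition is forced to be reduced: its length bounds `ℓ(vu⁻¹)` from above, and
subadditivity of length gives the reverse inequality. This removes the word, so order questions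
become length arithmetic. -/
theorem leftWeakLE_iff {u v : W} :
    LeftWeakLE cs u v ↔ cs.length v = cs.length u + cs.length (v * u⁻¹) := by
  constructor
  · rintro ⟨ω, h1, h2⟩
    have h3 : v * u⁻¹ = cs.wordProd ω := by rw [h1]; group
    have h4 := cs.length_wordProd_le ω
    have h5 := cs.length_mul_le (v * u⁻¹) u
    rw [inv_mul_cancel_right] at h5
    rw [h3] at h5 ⊢
    omega
  · intro h
    obtain ⟨ω, hr, hω⟩ := cs.exists_isReduced (v * u⁻¹)
    exact ⟨ω, by rw [← hω]; group, by rw [h, hω, hr.eq]⟩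

variable [Finite W]

variable (cs) in
theorem length_conj_longest (w : W) :
    cs.length (longest cs * w * longest cs) = cs.length w := by
  have h1 := length_mul_longest cs (longest cs * w)
  have h2 := length_longest_mul cs w
  omega

theorem longest_mul_longest_mul (w : W) : longest cs * (longest cs * w) = w := by
  rw [← mul_assoc, longest_mul_self, one_mul]

theorem mul_longest_mul_longest (w : W) : w * longest cs * longest cs = w := by
  rw [mul_assoc, longest_mul_self, mul_one]

theorem leftWeakLE_conj_longest {x y : W} :
    LeftWeakLE cs (longest cs * x * longest cs) (longest cs * y * longest cs) ↔
      LeftWeakLE cs x y := by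
  have h : longest cs * y * longest cs * (longest cs * x * longest cs)⁻¹ =
      longest cs * (y * x⁻¹) * longest cs := by
    simp only [mul_inv_rev, longest_inv, mul_assoc, longest_mul_longest_mul]
  rw [leftWeakLE_iff, leftWeakLE_iff, h]
  simp only [length_conj_longest]

/-- Right multiplication by `w₀` replaces every length by its complement in `ℓ(w₀)`, while
`(yw₀)(xw₀)⁻¹` is the inverse of `xy⁻¹` and so has the same length. -/
theorem leftWeakLE_mul_longest {x y : W} :
    LeftWeakLE cs (x * longest cs) (y * longest cs) ↔ LeftWeakLE cs y x := by
  have h : y * longest cs * (x * longest cs)⁻¹ = (x * y⁻¹)⁻¹ := by group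
  rw [leftWeakLE_iff, leftWeakLE_iff, h, cs.length_inv]
  have h1 := length_mul_longest cs x
  have h2 := length_mul_longest cs y
  omega

/-- Multiplying both sides by `w₀` on the right reverses the order and turns `w₀x` into the
conjugate `w₀xw₀`; conjugation preserves the order. -/
theorem leftWeakLE_longest_mul {x y : W} :
    LeftWeakLE cs (longest cs * x) (longest cs * y) ↔ LeftWeakLE cs y x := by
  rw [← leftWeakLE_conj_longest (x := y), ← leftWeakLE_mul_longest]

/-- Conjugation by `w₀` preserves length and carries `s_{conjIndex i} w` to `s_i (w₀ww₀)`. -/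
theorem isLeftDescent_conj_longest {w : W} {i : B} :
    cs.IsLeftDescent (longest cs * w * longest cs) i ↔ cs.IsLeftDescent w (conjIndex cs i) := by
  unfold CoxeterSystem.IsLeftDescent
  rw [← length_conj_longest cs (cs.simple (conjIndex cs i) * w), simple_conjIndex,
    length_conj_longest]
  simp only [mul_assoc, longest_mul_longest_mul]

theorem isLeftDescent_mul_longest {w : W} {i : B} :
    cs.IsLeftDescent (w * longest cs) i ↔ ¬ cs.IsLeftDescent w i := by
  unfold CoxeterSystem.IsLeftDescent
  have h1 := length_mul_longest cs w
  have h2 := length_mul_longest cs (cs.simple i * w)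
  have h3 := cs.length_simple_mul_ne w i
  rw [← mul_assoc]
  omega

theorem isLeftDescent_longest_mul {w : W} {i : B} :
    cs.IsLeftDescent (longest cs * w) i ↔ ¬ cs.IsLeftDescent w (conjIndex cs i) := by
  rw [← isLeftDescent_conj_longest, ← isLeftDescent_mul_longest, mul_longest_mul_longest]

end WeakOrder

/-! ### Upper order ideals under order isomorphisms and anti-isomorphisms -/

section Ideals

variable {B W : Type*} [Group W] {M : CoxeterMatrix B} {cs : CoxeterSystem M W} {u v : W}

theorem mem_weakInterval_of_orderIso {τ : W ≃ W}
    (hτ : ∀ x y, LeftWeakLE cs (τ x) (τ y) ↔ LeftWeakLE cs x y) {w : W} :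
    τ w ∈ weakInterval cs (τ u) (τ v) ↔ w ∈ weakInterval cs u v := by
  simp [weakInterval, hτ]

theorem mem_weakInterval_of_antiIso {τ : W ≃ W}
    (hτ : ∀ x y, LeftWeakLE cs (τ x) (τ y) ↔ LeftWeakLE cs y x) {w : W} :
    τ w ∈ weakInterval cs (τ v) (τ u) ↔ w ∈ weakInterval cs u v := by
  simp [weakInterval, hτ, and_comm]

theorem IsUpperOrderIdeal.image_orderIso {Y : Set W} (hY : IsUpperOrderIdeal cs u v Y) {τ : W ≃ W}
    (hτ : ∀ x y, LeftWeakLE cs (τ x) (τ y) ↔ LeftWeakLE cs x y) :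
    IsUpperOrderIdeal cs (τ u) (τ v) (τ '' Y) where
  subset := by
    rintro _ ⟨y, hy, rfl⟩
    exact (mem_weakInterval_of_orderIso hτ).2 (hY.subset hy)
  upper := by
    rintro _ ⟨x, hx, rfl⟩ y hy hxy
    obtain ⟨y, rfl⟩ := τ.surjective y
    exact ⟨y, hY.upper x hx y ((mem_weakInterval_of_orderIso hτ).1 hy) ((hτ x y).1 hxy), rfl⟩

/-- An order-reversing bijection sends an upper ideal to a lower one, whose complement in the image
interval is upper. -/
theorem IsUpperOrderIdeal.diff_image_antiIso {Y : Set W} (hY : IsUpperOrderIdeal cs u v Y)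
    {τ : W ≃ W} (hτ : ∀ x y, LeftWeakLE cs (τ x) (τ y) ↔ LeftWeakLE cs y x) :
    IsUpperOrderIdeal cs (τ v) (τ u) (weakInterval cs (τ v) (τ u) \ τ '' Y) where
  subset := Set.sdiff_subset
  upper := by
    rintro x ⟨hx, hx'⟩ y hy hxy
    refine ⟨hy, ?_⟩
    rintro ⟨b, hb, rfl⟩
    obtain ⟨a, rfl⟩ := τ.surjective x
    exact hx' ⟨a, hY.upper b hb a ((mem_weakInterval_of_antiIso hτ).1 hx) ((hτ a b).1 hxy), rfl⟩

end Ideals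

/-! ### Linearity over the 0-Hecke algebra, checked on generators -/

section HeckeLinear

variable {𝕜 B : Type*} [Field 𝕜] {M : CoxeterMatrix B}
  {V N : Type*} [AddCommGroup V] [Module 𝕜 V] [Module (HeckeAlgebra 𝕜 M) V]
  [IsScalarTower 𝕜 (HeckeAlgebra 𝕜 M) V] [AddCommGroup N] [Module 𝕜 N]
  [Module (HeckeAlgebra 𝕜 M) N] [IsScalarTower 𝕜 (HeckeAlgebra 𝕜 M) N]

/-- A linear map commuting with the generators is linear over the 0-Hecke algebra. -/
def heckeLinearMap (g : V →ₗ[𝕜] N)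
    (hg : ∀ i v, g (heckeGen 𝕜 (M := M) i • v) = heckeGen 𝕜 (M := M) i • g v) :
    V →ₗ[HeckeAlgebra 𝕜 M] N where
  toFun := g
  map_add' := map_add g
  map_smul' a v := by
    have ha : a ∈ Algebra.adjoin 𝕜 (Set.range (heckeGen 𝕜 (M := M))) := by
      rw [adjoin_range_heckeGen]; trivial
    rw [RingHom.id_apply]
    induction ha using Algebra.adjoin_induction generalizing v with
    | mem a ha => obtain ⟨i, rfl⟩ := ha; exact hg i v
    | algebraMap c => rw [algebraMap_smul, algebraMap_smul, map_smul]
    | add a b _ _ iha ihb => rw [add_smul, add_smul, map_add, iha, ihb]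
    | mul a b _ _ iha ihb => rw [mul_smul, mul_smul, iha, ihb]

end HeckeLinear

/-! ### Linear isomorphisms between interval modules and their duals -/

section Isomorphisms

variable {𝕜 B W : Type*} [Field 𝕜] [Group W] {M : CoxeterMatrix B} {cs : CoxeterSystem M W}
  {u v u' v' : W}

theorem mem_spanSpace {Y : Set W} {x : IntervalModule cs 𝕜 u v} :
    x ∈ spanSpace cs 𝕜 u v Y ↔
      ∀ w : weakInterval cs u v, (w : W) ∉ Y → (intervalBasis cs 𝕜 u v).repr x w = 0 := by
  rw [spanSpace, Module.Basis.mem_span_image]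
  constructor
  · intro h w hw
    by_contra hc
    exact hw (h (Finsupp.mem_support_iff.2 hc))
  · intro h w hw
    by_contra hc
    exact Finsupp.mem_support_iff.1 hw (h w hc)

/-- The bijection between two intervals induced by a permutation of the group. -/
def intervalEquiv (τ : W ≃ W)
    (hI : ∀ w, τ w ∈ weakInterval cs u' v' ↔ w ∈ weakInterval cs u v) :
    weakInterval cs u v ≃ weakInterval cs u' v' :=
  τ.subtypeEquiv fun w => (hI w).symm

theorem basisOrZero_coe (w : weakInterval cs u v) :
    basisOrZero cs 𝕜 u v w = intervalBasis cs 𝕜 u v w := by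
  simp [basisOrZero]

/-! ### Order-preserving bijections: quotient modules -/

section Covariant

variable (τ : W ≃ W) (hI : ∀ w, τ w ∈ weakInterval cs u' v' ↔ w ∈ weakInterval cs u v)

/-- The linear isomorphism between interval modules induced by a bijection of intervals. -/
noncomputable def intervalModuleEquiv :
    IntervalModule cs 𝕜 u v ≃ₗ[𝕜] IntervalModule cs 𝕜 u' v' :=
  (intervalBasis cs 𝕜 u v).equiv (intervalBasis cs 𝕜 u' v') (intervalEquiv τ hI)

theorem intervalModuleEquiv_basisOrZero (w : W) :
    intervalModuleEquiv τ hI (basisOrZero cs 𝕜 u v w) = basisOrZero cs 𝕜 u' v' (τ w) := by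
  by_cases h : w ∈ weakInterval cs u v
  · rw [basisOrZero, dif_pos h, basisOrZero, dif_pos ((hI w).2 h), intervalModuleEquiv,
      Module.Basis.equiv_apply]
    rfl
  · rw [basisOrZero, dif_neg h, basisOrZero, dif_neg (mt (hI w).1 h), map_zero]

/-- On a basis element, `intervalOp` is `basisOrZero` applied to `leftUp`, so compatibility of `τ`
with `leftUp` on the whole group suffices. The truncation to `0` takes care of itself, because `τ`
respects membership in the intervals. -/
theorem intervalModuleEquiv_intervalOp {i j : B}
    (hup : ∀ w, τ (leftUp cs j w) = leftUp cs i (τ w)) (x : IntervalModule cs 𝕜 u v) :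
    intervalModuleEquiv τ hI (intervalOp cs 𝕜 u v j x) =
      intervalOp cs 𝕜 u' v' i (intervalModuleEquiv τ hI x) := by
  have : (intervalModuleEquiv τ hI).toLinearMap ∘ₗ intervalOp cs 𝕜 u v j =
      intervalOp cs 𝕜 u' v' i ∘ₗ (intervalModuleEquiv τ hI).toLinearMap := by
    refine (intervalBasis cs 𝕜 u v).ext fun w => ?_
    have hw : intervalModuleEquiv τ hI (intervalBasis cs 𝕜 u v w) =
        intervalBasis cs 𝕜 u' v' (intervalEquiv τ hI w) := by
      rw [intervalModuleEquiv, Module.Basis.equiv_apply]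
    simp only [LinearMap.comp_apply, LinearEquiv.coe_coe]
    rw [intervalOp_basis, intervalModuleEquiv_basisOrZero, hup, hw, intervalOp_basis]
    rfl
  exact LinearMap.congr_fun this x

theorem map_spanSpace (Y : Set W) :
    (spanSpace cs 𝕜 u v Y).map (intervalModuleEquiv τ hI).toLinearMap =
      spanSpace cs 𝕜 u' v' (τ '' Y) := by
  rw [spanSpace, spanSpace, Submodule.map_span, ← Set.image_comp]
  congr 1
  ext x
  constructor
  · rintro ⟨w, hw, rfl⟩
    exact ⟨intervalEquiv τ hI w, ⟨w, hw, rfl⟩, by simp [intervalModuleEquiv]⟩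
  · rintro ⟨z, ⟨y, hy, hyz⟩, rfl⟩
    obtain ⟨w, rfl⟩ := (intervalEquiv τ hI).surjective z
    have : y = w := τ.injective hyz
    exact ⟨w, by rwa [this] at hy, by simp [intervalModuleEquiv]⟩

theorem nonempty_twist_quotient_equiv
    (hI : ∀ w, τ w ∈ weakInterval cs u' v' ↔ w ∈ weakInterval cs u v)
    (α : HeckeAlgebra 𝕜 M →ₐ[𝕜] HeckeAlgebra 𝕜 M) (σ : B → B)
    (hα : ∀ i, α (heckeGen 𝕜 i) = heckeGen 𝕜 (σ i))
    (hup : ∀ i w, τ (leftUp cs (σ i) w) = leftUp cs i (τ w))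
    {Y : Set W} (hY : IsUpperOrderIdeal cs u v Y) (hY' : IsUpperOrderIdeal cs u' v' (τ '' Y)) :
    Nonempty (Twist α (IntervalModule cs 𝕜 u v ⧸ idealSubmodule 𝕜 hY) ≃ₗ[HeckeAlgebra 𝕜 M]
      IntervalModule cs 𝕜 u' v' ⧸ idealSubmodule 𝕜 hY') := by
  let e : (IntervalModule cs 𝕜 u v ⧸ idealSubmodule 𝕜 hY) ≃ₗ[𝕜]
      (IntervalModule cs 𝕜 u' v' ⧸ idealSubmodule 𝕜 hY') :=
    -- The basis bijection is only known to be `𝕜`-linear here, so the quotients are compared over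
    -- `𝕜`; the `𝕜`-space underlying `idealSubmodule` is `spanSpace` by definition, which lets
    -- `map_spanSpace` apply.
    (Submodule.Quotient.restrictScalarsEquiv 𝕜 (idealSubmodule 𝕜 hY)).symm ≪≫ₗ
      Submodule.Quotient.equiv _ _ (intervalModuleEquiv τ hI) (map_spanSpace τ hI Y) ≪≫ₗ
      Submodule.Quotient.restrictScalarsEquiv 𝕜 (idealSubmodule 𝕜 hY')
  have he : ∀ x, e (Submodule.Quotient.mk x) =
      Submodule.Quotient.mk (intervalModuleEquiv τ hI x) := fun x => rfl
  refine ⟨LinearEquiv.ofBijective (heckeLinearMap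
    ((Twist.of α (IntervalModule cs 𝕜 u v ⧸ idealSubmodule 𝕜 hY)).symm ≪≫ₗ e).toLinearMap ?_)
    (LinearEquiv.bijective _)⟩
  intro i q
  obtain ⟨q, rfl⟩ := (Twist.of α _).surjective q
  obtain ⟨x, rfl⟩ := Submodule.Quotient.mk_surjective _ q
  rw [Twist.smul_of, hα]
  simp only [LinearEquiv.coe_coe, LinearEquiv.trans_apply, LinearEquiv.symm_apply_apply]
  rw [← Submodule.Quotient.mk_smul, he, he, ← Submodule.Quotient.mk_smul, heckeGen_smul,
    heckeGen_smul, intervalModuleEquiv_intervalOp τ hI (hup i)]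

end Covariant

/-! ### Order-reversing bijections: the signed pairing and annihilators -/

section Contravariant

variable (τ : W ≃ W) (hI : ∀ w, τ w ∈ weakInterval cs u' v' ↔ w ∈ weakInterval cs u v)

open Classical in
variable (cs 𝕜) in
/-- The signed incidence `(-1) ^ ℓ(w)` if `τ w = x`, and `0` otherwise. -/
noncomputable def signedDelta (w x : W) : 𝕜 := if τ w = x then (-1) ^ cs.length w else 0

open Classical in
-- The adjunction between `1 - π_j` and `π_i`, stated on the whole group without intervals. On a
-- pair `w < s_j w`, the transpose of `1 - π_j` fixes the dual vector of `w` and sends that of `s_j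
-- w` to minus that of `w`. On the other side `τ(s_j w)` lies below `τ w`, and `π_i` sends both to
-- `τ w`. The sign `(-1)^ℓ(w)` absorbs the discrepancy.
theorem signedDelta_leftUp {i j : B} (hmul : ∀ w, τ (cs.simple j * w) = cs.simple i * τ w)
    (hd : ∀ w, cs.IsLeftDescent (τ w) i ↔ ¬ cs.IsLeftDescent w j) (w x : W) :
    signedDelta 𝕜 cs τ w x - signedDelta 𝕜 cs τ (leftUp cs j w) x =
      signedDelta 𝕜 cs τ w (leftUp cs i x) := by
  obtain ⟨y, rfl⟩ := τ.surjective x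
  -- Since `τ` exchanges descents and non-descents, going up from `τ y` means going down from `y`.
  have h1 : leftUp cs i (τ y) = if cs.IsLeftDescent y j then τ (cs.simple j * y) else τ y := by
    by_cases h : cs.IsLeftDescent y j <;> simp [leftUp, hd, h, hmul]
  have hy := cs.isLeftDescent_iff_not_isLeftDescent_mul (w := y) (i := j)
  by_cases hw : cs.IsLeftDescent w j
  -- Both sides vanish when `j` is a descent of `w`: the left side cancels because `leftUp` fixes
  -- `w`, and on the right the lower element of the pair containing `y` does not have `j` as a
  -- descent.
  · have h2 : w ≠ if cs.IsLeftDescent y j then cs.simple j * y else y := by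
      rintro rfl
      split_ifs at hw with h
      · exact hy.1 h hw
      · exact h hw
    have h3 : τ w ≠ leftUp cs i (τ y) := by
      rw [h1]
      intro h
      apply h2
      split_ifs at h ⊢ <;> exact τ.injective h
    rw [leftUp, if_pos hw, sub_self, signedDelta, if_neg h3]
  · have hl := (cs.not_isLeftDescent_iff).1 hw
    have h2 : leftUp cs j w = cs.simple j * w := if_neg hw
    have hsw : cs.simple j * w = y ↔ w = cs.simple j * y := by
      constructor
      · rintro rfl; simp
      · rintro rfl; simp
    -- Here `s_j w` is one longer than `w`, so its sign is opposite and the subtraction becomes an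
    -- addition; at most one of the two terms on the left is nonzero, according to whether `j` is a
    -- descent of `y`.
    simp only [h2, signedDelta, h1, hl, τ.apply_eq_iff_eq, hsw]
    by_cases hyd : cs.IsLeftDescent y j
    · have hne : w ≠ y := by rintro rfl; exact hw hyd
      simp only [hyd, hne, if_true, if_false, pow_succ, τ.apply_eq_iff_eq]
      split_ifs <;> simp
    · have hne : w ≠ cs.simple j * y := by
        rintro rfl
        rw [← cs.simple_mul_simple_cancel_left (w := y) j] at hyd
        exact hyd ((cs.isLeftDescent_iff_not_isLeftDescent_mul).2 (by simpa using hw))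
      simp [hyd, hne]

variable [Finite W]

open Classical in
/-- The linear isomorphism from an interval module to the dual of another one, sending `τ w` to
the dual basis element of `w` up to the sign `(-1) ^ ℓ(w)`. -/
noncomputable def intervalDualEquiv :
    IntervalModule cs 𝕜 u' v' ≃ₗ[𝕜] Module.Dual 𝕜 (IntervalModule cs 𝕜 u v) :=
  (intervalBasis cs 𝕜 u' v').equiv
    ((intervalBasis cs 𝕜 u v).dualBasis.unitsSMul fun w => (-1) ^ cs.length (w : W))
    (intervalEquiv τ hI).symm

theorem intervalDualEquiv_apply (x : IntervalModule cs 𝕜 u' v') (w : weakInterval cs u v) :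
    intervalDualEquiv τ hI x (intervalBasis cs 𝕜 u v w) =
      (-1) ^ cs.length (w : W) * (intervalBasis cs 𝕜 u' v').repr x (intervalEquiv τ hI w) := by
  classical
  have : (LinearMap.applyₗ (intervalBasis cs 𝕜 u v w)) ∘ₗ
      (intervalDualEquiv τ hI).toLinearMap = ((-1) ^ cs.length (w : W) : 𝕜) •
        (intervalBasis cs 𝕜 u' v').coord (intervalEquiv τ hI w) := by
    refine (intervalBasis cs 𝕜 u' v').ext fun z => ?_
    obtain ⟨z, rfl⟩ := (intervalEquiv τ hI).surjective z
    simp only [LinearMap.comp_apply, LinearEquiv.coe_coe, LinearMap.applyₗ_apply_apply,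
      intervalDualEquiv, Module.Basis.equiv_apply, Equiv.symm_apply_apply,
      Module.Basis.unitsSMul_apply, LinearMap.smul_apply, Module.Basis.coord_apply,
      Module.Basis.repr_self, Module.Basis.coe_dualBasis, Units.smul_def,
      Finsupp.single_apply, EmbeddingLike.apply_eq_iff_eq]
    by_cases h : z = w
    · subst h; simp
    · simp [h, Ne.symm h]
  exact LinearMap.congr_fun this x

/-- Extends the pairing formula past the boundary of the intervals, as needed when `leftUp` leaves
one of them. Membership of one argument suffices, because `τ w = x` then forces that of the other;
with both outside, the left side is `0` while `signedDelta` may be a sign. -/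
theorem intervalDualEquiv_basisOrZero (w x : W)
    (h : w ∈ weakInterval cs u v ∨ x ∈ weakInterval cs u' v') :
    intervalDualEquiv τ hI (basisOrZero cs 𝕜 u' v' x) (basisOrZero cs 𝕜 u v w) =
      signedDelta 𝕜 cs τ w x := by
  classical
  by_cases hw : w ∈ weakInterval cs u v
  · rw [show basisOrZero cs 𝕜 u v w = _ from dif_pos hw, intervalDualEquiv_apply, signedDelta]
    by_cases hx : x ∈ weakInterval cs u' v'
    · rw [basisOrZero, dif_pos hx, Module.Basis.repr_self, Finsupp.single_apply]
      have : (⟨x, hx⟩ = intervalEquiv τ hI ⟨w, hw⟩) ↔ τ w = x := by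
        rw [Subtype.ext_iff, eq_comm]; rfl
      simp only [this, mul_ite, mul_one, mul_zero]
    · have : τ w ≠ x := by rintro rfl; exact hx ((hI w).2 hw)
      rw [basisOrZero, dif_neg hx]; simp [this]
  · have hx := h.resolve_left hw
    have : τ w ≠ x := by rintro rfl; exact hw ((hI w).1 hx)
    rw [show basisOrZero cs 𝕜 u v w = _ from dif_neg hw, map_zero, signedDelta, if_neg this]

theorem intervalDualEquiv_intervalOp {i j : B}
    (hmul : ∀ w, τ (cs.simple j * w) = cs.simple i * τ w)
    (hd : ∀ w, cs.IsLeftDescent (τ w) i ↔ ¬ cs.IsLeftDescent w j)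
    (x : IntervalModule cs 𝕜 u' v') (y : IntervalModule cs 𝕜 u v) :
    intervalDualEquiv τ hI (intervalOp cs 𝕜 u' v' i x) y =
      intervalDualEquiv τ hI x (y - intervalOp cs 𝕜 u v j y) := by
  let E := (intervalDualEquiv (𝕜 := 𝕜) τ hI).toLinearMap
  have : E ∘ₗ intervalOp cs 𝕜 u' v' i = E - E.compl₂ (intervalOp cs 𝕜 u v j) := by
    refine (intervalBasis cs 𝕜 u' v').ext fun z => (intervalBasis cs 𝕜 u v).ext fun w => ?_
    simp only [E, LinearMap.comp_apply, LinearMap.sub_apply, LinearMap.compl₂_apply,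
      LinearEquiv.coe_coe, intervalOp_basis]
    rw [← basisOrZero_coe, ← basisOrZero_coe, intervalDualEquiv_basisOrZero τ hI _ _ (Or.inl w.2),
      intervalDualEquiv_basisOrZero τ hI _ _ (Or.inl w.2),
      intervalDualEquiv_basisOrZero τ hI _ _ (Or.inr z.2), signedDelta_leftUp τ hmul hd]
  have h := LinearMap.congr_fun (LinearMap.congr_fun this x) y
  rw [map_sub]
  exact h

/-- Identifies the annihilator of `𝕜Y`. Pairing `x` with a basis element `w` gives, up to an
invertible sign, the coordinate of `x` at `τ w`; so `x` kills `𝕜Y` exactly when its coordinates on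
`τ Y` vanish. -/
theorem mem_spanSpace_diff_iff {Y : Set W} (hY : Y ⊆ weakInterval cs u v)
    (x : IntervalModule cs 𝕜 u' v') :
    x ∈ spanSpace cs 𝕜 u' v' (weakInterval cs u' v' \ τ '' Y) ↔
      ∀ y ∈ spanSpace cs 𝕜 u v Y, intervalDualEquiv τ hI x y = 0 := by
  have h1 : (∀ y ∈ spanSpace cs 𝕜 u v Y, intervalDualEquiv τ hI x y = 0) ↔
      ∀ w : weakInterval cs u v, (w : W) ∈ Y →
        intervalDualEquiv τ hI x (intervalBasis cs 𝕜 u v w) = 0 := by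
    constructor
    · exact fun h w hw => h _ (Submodule.subset_span ⟨w, hw, rfl⟩)
    · intro h y hy
      have : spanSpace cs 𝕜 u v Y ≤ LinearMap.ker (intervalDualEquiv τ hI x) := by
        refine Submodule.span_le.2 ?_
        rintro _ ⟨w, hw, rfl⟩
        exact h w hw
      exact this hy
  rw [h1, mem_spanSpace]
  simp only [intervalDualEquiv_apply, mul_eq_zero, pow_eq_zero_iff', neg_eq_zero, one_ne_zero,
    false_and, false_or]
  constructor
  · exact fun h w hw => h _ fun hc => hc.2 ⟨w, hw, rfl⟩
  · intro h z hz
    by_contra hc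
    refine hz ⟨z.2, ?_⟩
    rintro ⟨y, hy, hyz⟩
    refine hc ?_
    have : z = intervalEquiv τ hI ⟨y, hY hy⟩ := Subtype.ext hyz.symm
    rw [this]
    exact h _ hy

/-- The module `V` is left abstract, to be taken as `θ[χ[-]]` or `φ[θ[χ[-]]]` of the quotient: all
that matters is that it is the dual space with `π_i` acting as the transpose of `1 - π_{σ i}`.
Pulling functionals back along the quotient map embeds it in the dual of `B(u, v)`, and the signed
pairing moves it into the other interval module. -/
theorem nonempty_dual_quotient_equiv {V : Type*} [AddCommGroup V] [Module 𝕜 V]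
    [Module (HeckeAlgebra 𝕜 M) V] [IsScalarTower 𝕜 (HeckeAlgebra 𝕜 M) V]
    (hI : ∀ w, τ w ∈ weakInterval cs u' v' ↔ w ∈ weakInterval cs u v)
    (σ : B → B)
    (hmul : ∀ i w, τ (cs.simple (σ i) * w) = cs.simple i * τ w)
    (hd : ∀ i w, cs.IsLeftDescent (τ w) i ↔ ¬ cs.IsLeftDescent w (σ i))
    {Y : Set W} (hY : IsUpperOrderIdeal cs u v Y)
    (hZ : IsUpperOrderIdeal cs u' v' (weakInterval cs u' v' \ τ '' Y))
    (e : V ≃ₗ[𝕜] Module.Dual 𝕜 (IntervalModule cs 𝕜 u v ⧸ idealSubmodule 𝕜 hY))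
    (he : ∀ i x q, e (heckeGen 𝕜 (M := M) i • x) q = e x (q - heckeGen 𝕜 (M := M) (σ i) • q)) :
    Nonempty (V ≃ₗ[HeckeAlgebra 𝕜 M] idealSubmodule 𝕜 hZ) := by
  let P := idealSubmodule 𝕜 hY
  let mk : IntervalModule cs 𝕜 u v →ₗ[𝕜] IntervalModule cs 𝕜 u v ⧸ P :=
    P.mkQ.restrictScalars 𝕜
  have hmk : Function.Surjective mk := P.mkQ_surjective
  let D := intervalDualEquiv (𝕜 := 𝕜) τ hI
  let F : V →ₗ[𝕜] IntervalModule cs 𝕜 u' v' :=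
    D.symm.toLinearMap ∘ₗ mk.dualMap ∘ₗ e.toLinearMap
  have hF : ∀ x y, D (F x) y = e x (mk y) := fun x y => by simp [F]
  have hgen : ∀ i x, F (heckeGen 𝕜 (M := M) i • x) = heckeGen 𝕜 (M := M) i • F x := by
    intro i x
    apply D.injective
    refine LinearMap.ext fun y => ?_
    rw [hF, he, heckeGen_smul, intervalDualEquiv_intervalOp τ hI (hmul i) (hd i), hF, map_sub mk,
      ← heckeGen_smul]
    rfl
  let G := heckeLinearMap F hgen
  have hinj : Function.Injective G := by
    intro x y hxy
    apply e.injective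
    refine LinearMap.ext fun q => ?_
    obtain ⟨q, rfl⟩ := hmk q
    rw [← hF, ← hF]
    exact congrArg (fun z => D z q) hxy
  have hrange : LinearMap.range G = idealSubmodule 𝕜 hZ := by
    ext x
    have hx : x ∈ idealSubmodule 𝕜 hZ ↔ ∀ y ∈ spanSpace cs 𝕜 u v Y, D x y = 0 :=
      mem_spanSpace_diff_iff τ hI hY.subset x
    rw [hx, LinearMap.mem_range]
    constructor
    · rintro ⟨z, rfl⟩ y hy
      have : mk y = 0 := (Submodule.Quotient.mk_eq_zero P).2 hy
      exact (hF z y).trans (by rw [this, map_zero])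
    · intro h
      -- The functional paired with `x` vanishes on `𝕜Y`, so it factors through the quotient; it is
      -- only `𝕜`-linear, hence the passage through `restrictScalars`.
      let f : Module.Dual 𝕜 (IntervalModule cs 𝕜 u v ⧸ P) :=
        (P.restrictScalars 𝕜).liftQ (D x) h ∘ₗ
          (Submodule.Quotient.restrictScalarsEquiv 𝕜 P).symm.toLinearMap
      refine ⟨e.symm f, D.injective (LinearMap.ext fun y => ?_)⟩
      refine (hF _ y).trans ?_
      rw [e.apply_symm_apply]
      rfl
  exact ⟨(LinearEquiv.ofInjective G hinj).trans (LinearEquiv.ofEq _ _ hrange)⟩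

end Contravariant

end Isomorphisms

/-! ### The twisting maps on generators -/

section Twists

variable {𝕜 B W : Type*} [Field 𝕜] {M : CoxeterMatrix B}

theorem theta_heckeGen (i : B) : theta 𝕜 M (heckeGen 𝕜 i) = 1 - heckeGen 𝕜 i :=
  liftHecke_heckeGen _ _ _ i

theorem chi_heckeGen (i : B) : chi 𝕜 M (heckeGen 𝕜 i) = MulOpposite.op (heckeGen 𝕜 i) :=
  liftHecke_heckeGen _ _ _ i

theorem phi_heckeGen [Group W] [Finite W] (cs : CoxeterSystem M W) (i : B) :
    phi 𝕜 cs (heckeGen 𝕜 i) = heckeGen 𝕜 (conjIndex cs i) :=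
  liftHecke_heckeGen _ _ _ i

variable {V : Type*} [AddCommGroup V] [Module 𝕜 V] [Module (HeckeAlgebra 𝕜 M) V]
  [IsScalarTower 𝕜 (HeckeAlgebra 𝕜 M) V]

/-- Supplies the hypothesis `he` of `nonempty_dual_quotient_equiv`: `χ` fixes `1 - π_i`, so the
twisted action on functionals is precomposition with `1 - π_i`. -/
theorem chiDual_theta_smul (i : B) (f : ChiDual 𝕜 M V) (q : V) :
    (ChiDual.of 𝕜 M V).symm (theta 𝕜 M (heckeGen 𝕜 i) • f) q =
      (ChiDual.of 𝕜 M V).symm f (q - heckeGen 𝕜 (M := M) i • q) := by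
  rw [ChiDual.smul_apply, theta_heckeGen, map_sub, map_one, chi_heckeGen, MulOpposite.unop_sub,
    MulOpposite.unop_one, MulOpposite.unop_op, sub_smul, one_smul]

end Twists

end ZeroHecke

/-! ### Assembly for the three permutations -/

theorem mainTheorem3 {𝕜 B W : Type*} [Field 𝕜] [Group W] [Finite W] {M : CoxeterMatrix B}
    (cs : CoxeterSystem M W) (u v : W) (huv : LeftWeakLE cs u v)
    (Y : Set W) (hY : IsUpperOrderIdeal cs u v Y) :
    let w₀ := longest cs
    (LeftWeakLE cs (w₀ * u * w₀) (w₀ * v * w₀) ∧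
      ∃ hY' : IsUpperOrderIdeal cs (w₀ * u * w₀) (w₀ * v * w₀) ((fun y => w₀ * y * w₀) '' Y),
        Nonempty (PhiTwist cs 𝕜 (IntervalModule cs 𝕜 u v ⧸ idealSubmodule 𝕜 hY)
          ≃ₗ[HeckeAlgebra 𝕜 M]
          IntervalModule cs 𝕜 (w₀ * u * w₀) (w₀ * v * w₀) ⧸ idealSubmodule 𝕜 hY')) ∧
    (LeftWeakLE cs (v * w₀) (u * w₀) ∧
      ∃ hZ : IsUpperOrderIdeal cs (v * w₀) (u * w₀)
          (weakInterval cs (v * w₀) (u * w₀) \ (fun y => y * w₀) '' Y),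
        Nonempty (HatTheta M 𝕜 (IntervalModule cs 𝕜 u v ⧸ idealSubmodule 𝕜 hY)
          ≃ₗ[HeckeAlgebra 𝕜 M] idealSubmodule 𝕜 hZ)) ∧
    (LeftWeakLE cs (w₀ * v) (w₀ * u) ∧
      ∃ hZ : IsUpperOrderIdeal cs (w₀ * v) (w₀ * u)
          (weakInterval cs (w₀ * v) (w₀ * u) \ (fun y => w₀ * y) '' Y),
        Nonempty (HatOmega cs 𝕜 (IntervalModule cs 𝕜 u v ⧸ idealSubmodule 𝕜 hY)
          ≃ₗ[HeckeAlgebra 𝕜 M] idealSubmodule 𝕜 hZ)) := by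
  intro w₀
  let τ₁ : W ≃ W := (Equiv.mulLeft w₀).trans (Equiv.mulRight w₀)
  let τ₂ : W ≃ W := Equiv.mulRight w₀
  let τ₃ : W ≃ W := Equiv.mulLeft w₀
  have h₁ : ∀ x y, LeftWeakLE cs (τ₁ x) (τ₁ y) ↔ LeftWeakLE cs x y :=
    fun _ _ => leftWeakLE_conj_longest
  have h₂ : ∀ x y, LeftWeakLE cs (τ₂ x) (τ₂ y) ↔ LeftWeakLE cs y x :=
    fun _ _ => leftWeakLE_mul_longest
  have h₃ : ∀ x y, LeftWeakLE cs (τ₃ x) (τ₃ y) ↔ LeftWeakLE cs y x :=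
    fun _ _ => leftWeakLE_longest_mul
  refine ⟨⟨(h₁ u v).2 huv, hY.image_orderIso h₁, ?_⟩, ⟨(h₂ v u).2 huv, hY.diff_image_antiIso h₂, ?_⟩,
    ⟨(h₃ v u).2 huv, hY.diff_image_antiIso h₃, ?_⟩⟩
  · refine nonempty_twist_quotient_equiv τ₁ (fun _ => mem_weakInterval_of_orderIso h₁) (phi 𝕜 cs)
      (conjIndex cs) (phi_heckeGen cs) (fun i w => ?_) hY (hY.image_orderIso h₁)
    change w₀ * _ * w₀ = leftUp cs i (w₀ * w * w₀)
    unfold leftUp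
    rw [isLeftDescent_conj_longest]
    split_ifs
    · rfl
    · simp only [w₀, simple_conjIndex, mul_assoc, longest_mul_longest_mul]
  · exact nonempty_dual_quotient_equiv τ₂ (fun _ => mem_weakInterval_of_antiIso h₂) id
      (fun _ _ => mul_assoc _ _ _) (fun _ _ => isLeftDescent_mul_longest) hY
      -- The required identification with the dual space is the identity map; only the Hecke action
      -- changes.
      (hY.diff_image_antiIso h₂) ((Twist.of (theta 𝕜 M) _).symm ≪≫ₗ (ChiDual.of 𝕜 M _).symm)
      (fun i x q => chiDual_theta_smul i _ q)
  · refine nonempty_dual_quotient_equiv τ₃ (fun _ => mem_weakInterval_of_antiIso h₃) (conjIndex cs)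
      (fun i w => ?_) (fun _ _ => isLeftDescent_longest_mul) hY (hY.diff_image_antiIso h₃)
      ((Twist.of (phi 𝕜 cs) _).symm ≪≫ₗ (Twist.of (theta 𝕜 M) _).symm ≪≫ₗ (ChiDual.of 𝕜 M _).symm)
      (fun i x q => ?_)
    · change w₀ * (_ * w) = _ * (w₀ * w)
      simp only [w₀, simple_conjIndex, mul_assoc, longest_mul_longest_mul]
    · have h := chiDual_theta_smul (conjIndex cs i)
        ((Twist.of (theta 𝕜 M) _).symm ((Twist.of (phi 𝕜 cs) _).symm x)) q
      refine Eq.trans ?_ h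
      -- In the double twist `π_i` acts as `θ(φ(π_i))`; once `π_{conjIndex i}` is written as
      -- `φ(π_i)`, both sides agree by unfolding the twists.
      rw [← phi_heckeGen cs]
      rfl
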